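/- Let $(R,\mathfrak m)$ be a Noetherian local ring of embedding dimension $2$ (that is, $\dim_{R/\mathfrak m}\mathfrak m/\mathfrak m^2=2$) that is not a zero-dimensional complete intersection. Then there is an isomorphism of $R$-modules $$\operatorname{syz}_1^R(\mathfrak m)\;\cong\;\mathfrak m^*:=\operatorname{Hom}_R(\mathfrak m,R).$$ Here $\operatorname{syz}_1^R(\mathfrak m)$ denotes the first syzygy module in the minimal free resolution of $\mathfrak m$, i.e. the kernel of any surjection $R^n\to\mathfrak m$ that sends the standard basis to a minimal system of generators of $\mathfrak m$ (it is unique up to isomorphism). The ring $R$ is a complete intersection if its $\mathfrak m$-adic completion is isomorphic to $S/(s_1,\dots,s_c)$ for some regular local ring $S$ and some (possibly empty) $S$-regular sequence $s_1,\dots,s_c$; it is zero-dimensional if its Krull dimension is $0$. -/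

import Mathlib

/-- A Noetherian local ring `R` is a complete intersection if its completion at the maximal ideal
is isomorphic to `S / (s₁, …, s_c)` for a regular local ring `S` and an `S`-regular sequence
`s₁, …, s_c` (possibly empty). -/
def IsCompleteIntersectionLocalRing.{u} (R : Type u) [CommRing R] [IsLocalRing R] : Prop :=
  ∃ (S : Type u) (_ : CommRing S) (_ : IsRegularLocalRing S)
    (f : S →+* AdicCompletion (IsLocalRing.maximalIdeal R) R) (s : List S),
    Function.Surjective f ∧
    RingTheory.Sequence.IsRegular S s ∧
    RingHom.ker f = Ideal.ofList s

/-- A minimal free cover of a module `M` over a local ring `(R, 𝔪)`: a surjection `π : Rⁿ → M` with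
`ker π ⊆ 𝔪 Rⁿ`, i.e. one sending the standard basis to a minimal system of generators of `M`.
The first syzygy module `syz₁(M)` (well defined up to isomorphism) is the kernel of
any minimal free cover of `M`. -/
structure IsMinimalFreeCover {R M : Type*} [CommRing R] [IsLocalRing R] [AddCommGroup M]
    [Module R M] {n : ℕ} (π : (Fin n → R) →ₗ[R] M) : Prop where
  surjective : Function.Surjective π
  ker_le : LinearMap.ker π ≤ IsLocalRing.maximalIdeal R • (⊤ : Submodule R (Fin n → R))

open IsLocalRing Polynomial

/-! Let `x, y` be minimal generators of the maximal ideal `𝔪`. A functional `f` on `𝔪` gives the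
relation `-f(y) x + f(x) y = 0`, and `f ↦ (-f(y), f(x))` embeds `𝔪*` in the syzygies. A syzygy `u`
comes from a functional as soon as `v ↦ u₁v₀ - u₀v₁` kills all syzygies, that is, as soon as all 2×2
minors of relations on `x, y` vanish (`Ideal.nonempty_ker_equiv_dual`).

It remains to see that a nonzero minor `ad - bc` makes `R` a zero-dimensional complete intersection
(`IsLocalRing.zeroDimensional_isCompleteIntersection`). Suppose first that `𝔪` is nilpotent. Then
`R` is a quotient of a two-dimensional regular local ring `S` with parameters `X, Y` over `x, y`
(`IsLocalRing.exists_regularParameterPair_ringHom`, a form of Cohen's structure theorem). Lift the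
relations to `f = aX + bY`, `g = cX + dY`. Either `f, g` have only the Koszul relation or the
determinant lies in `(f, g)`; the latter is impossible, as its image in `R` is nonzero. So `S/(f,
g)` is Artinian with socle generated by the determinant, which then lies in every nonzero ideal. The
kernel of `S → R` avoids it, hence equals `(f, g)`.

In general, choose `N` with the minor outside `𝔪^N` and apply this to `R/𝔪^(N+1)`: the image of
`𝔪^N` misses the minor, so it is zero, and Nakayama gives `𝔪^N = 0`. -/

/-! ### Divisibility and regular pairs in local rings. -/

theorem IsLocalRing.exists_eq_mul_pow_not_dvd {R : Type*} [CommRing R]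
    [IsNoetherianRing R] [IsLocalRing R] {t : R} (ht : t ∈ maximalIdeal R) {s : R}
    (hs : s ≠ 0) : ∃ (n : ℕ) (u : R), s = u * t ^ n ∧ ¬ t ∣ u := by
  have h := Ideal.iInf_pow_eq_bot_of_isLocalRing (Ideal.span {t}) (by
    rw [Ne, Ideal.span_singleton_eq_top]; exact (mem_maximalIdeal _).1 ht)
  have h2 : ∃ n : ℕ, ¬ t ^ n ∣ s := by
    by_contra! hcon
    refine hs ?_
    have : s ∈ ⨅ i : ℕ, Ideal.span {t} ^ i := by
      simp only [Submodule.mem_iInf, Ideal.span_singleton_pow, Ideal.mem_span_singleton]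
      exact hcon
    rwa [h] at this
  classical
  obtain ⟨n, hn⟩ := Nat.exists_eq_succ_of_ne_zero (n := Nat.find h2) (by
    intro h0
    have := Nat.find_spec h2
    rw [h0] at this
    simp at this)
  have hlt : n < Nat.find h2 := by omega
  have hd : t ^ n ∣ s := not_not.1 (Nat.find_min h2 hlt)
  obtain ⟨u, hu⟩ := hd
  refine ⟨n, u, by rw [hu, mul_comm], fun ⟨v, hv⟩ => ?_⟩
  have := Nat.find_spec h2
  rw [hn] at this
  exact this ⟨v, by rw [hu, hv, pow_succ]; ring⟩

/-- Strip all powers of `t` from two nonzero factors: if their product were zero, so would be the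
product of the stripped factors, and primality would make `t` divide one of them. -/
theorem IsLocalRing.isDomain_of_isPrime_span_singleton {R : Type*} [CommRing R]
    [IsNoetherianRing R] [IsLocalRing R] {t : R} (ht : t ∈ maximalIdeal R)
    (hreg : ∀ u, t * u = 0 → u = 0) (hp : (Ideal.span {t}).IsPrime) : IsDomain R := by
  have hpow : ∀ (n : ℕ) (u : R), t ^ n * u = 0 → u = 0 := by
    intro n
    induction n with
    | zero => simp
    | succ n ih => exact fun u hu => ih u (hreg _ (by rw [← hu]; ring))
  have : NoZeroDivisors R := ⟨by
    intro a b hab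
    by_contra! hne
    obtain ⟨i, u, rfl, hu⟩ := exists_eq_mul_pow_not_dvd ht hne.1
    obtain ⟨j, v, rfl, hv⟩ := exists_eq_mul_pow_not_dvd ht hne.2
    have h0 : u * v = 0 := hpow (i + j) _ (by rw [← hab]; ring)
    rcases hp.mem_or_mem (show u * v ∈ Ideal.span {t} by rw [h0]; exact zero_mem _) with h | h
    · exact hu (Ideal.mem_span_singleton.1 h)
    · exact hv (Ideal.mem_span_singleton.1 h)⟩
  exact NoZeroDivisors.to_isDomain R

theorem RingTheory.Sequence.isWeaklyRegular_self_iff {S : Type*} [CommRing S] (rs : List S) :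
    RingTheory.Sequence.IsWeaklyRegular S rs ↔ ∀ (i : ℕ) (h : i < rs.length) (u : S),
      rs[i] * u ∈ Ideal.ofList (rs.take i) → u ∈ Ideal.ofList (rs.take i) := by
  rw [RingTheory.Sequence.isWeaklyRegular_iff]
  refine forall_congr' fun i => forall_congr' fun h => ?_
  rw [isSMulRegular_quotient_iff_mem_of_smul_mem]
  simp

theorem IsLocalRing.isRegular_pair_of_forall {S : Type*} [CommRing S] [IsLocalRing S] {f g : S}
    (hf : f ∈ maximalIdeal S) (hg : g ∈ maximalIdeal S) (h1 : ∀ u, f * u = 0 → u = 0)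
    (h2 : ∀ u, f ∣ g * u → f ∣ u) : RingTheory.Sequence.IsRegular S [f, g] := by
  rw [IsLocalRing.isRegular_iff_isWeaklyRegular_of_subset_maximalIdeal (by
    intro r hr
    simp only [List.mem_cons, List.not_mem_nil, or_false] at hr
    rcases hr with rfl | rfl <;> assumption), RingTheory.Sequence.isWeaklyRegular_self_iff]
  intro i hi u
  match i, hi with
  | 0, _ => simpa [Ideal.ofList] using h1 u
  | 1, _ => simpa [Ideal.ofList, Ideal.mem_span_singleton] using h2 u

/-! ### Two-dimensional regular local rings: gcds, syzygies of pairs, socles. -/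

/-- A regular system of parameters `x, y` of a local ring of dimension two. -/
structure IsRegularParameterPair {S : Type*} [CommRing S] [IsLocalRing S] (x y : S) : Prop where
  span_eq : Ideal.span {x, y} = maximalIdeal S
  regular_left : ∀ u, x * u = 0 → u = 0
  regular_right : ∀ u, x ∣ y * u → x ∣ u

/-- The relations between `f` and `g` are generated by the obvious one. -/
def HasKoszulSyzygies {S : Type*} [CommRing S] (f g : S) : Prop :=
  ∀ p q, p * f = q * g → ∃ t, p = t * g ∧ q = t * f

namespace IsRegularParameterPair

variable {S : Type*} [CommRing S] [IsLocalRing S] {x y : S}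

theorem left_mem (h : IsRegularParameterPair x y) : x ∈ maximalIdeal S :=
  h.span_eq ▸ Ideal.subset_span (by simp)

theorem right_mem (h : IsRegularParameterPair x y) : y ∈ maximalIdeal S :=
  h.span_eq ▸ Ideal.subset_span (by simp)

theorem exists_of_mem (h : IsRegularParameterPair x y) {s : S} (hs : s ∈ maximalIdeal S) :
    ∃ a b, s = a * x + b * y := by
  rw [← h.span_eq, Ideal.mem_span_pair] at hs
  obtain ⟨a, b, hab⟩ := hs
  exact ⟨a, b, hab.symm⟩

theorem exists_of_relation (h : IsRegularParameterPair x y) {a b : S} (hab : a * x + b * y = 0) :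
    ∃ t, a = t * y ∧ b = -(t * x) := by
  obtain ⟨t, ht⟩ := h.regular_right b ⟨-a, by linear_combination hab⟩
  refine ⟨-t, ?_, by rw [ht]; ring⟩
  have := h.regular_left (a + t * y) (by rw [ht] at hab; linear_combination hab)
  linear_combination this

theorem maximalIdeal_quotient (h : IsRegularParameterPair x y)
    [IsLocalRing (S ⧸ Ideal.span {x})] :
    maximalIdeal (S ⧸ Ideal.span {x}) = Ideal.span {Ideal.Quotient.mk _ y} := by
  have h1 : (maximalIdeal S).map (Ideal.Quotient.mk (Ideal.span {x})) =
      maximalIdeal (S ⧸ Ideal.span {x}) :=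
    IsLocalRing.map_maximalIdeal_of_surjective _ Ideal.Quotient.mk_surjective
  rw [← h1, ← h.span_eq, Ideal.map_span, Set.image_pair,
    Ideal.Quotient.eq_zero_iff_mem.2 (Ideal.mem_span_singleton_self x)]
  simp

theorem isLocalRing_quotient (h : IsRegularParameterPair x y) :
    IsLocalRing (S ⧸ Ideal.span {x}) := by
  have : Nontrivial (S ⧸ Ideal.span {x}) := Ideal.Quotient.nontrivial_iff.2 (by
    rw [Ne, Ideal.span_singleton_eq_top]; exact (mem_maximalIdeal _).1 h.left_mem)
  exact IsLocalRing.of_surjective' _ Ideal.Quotient.mk_surjective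

variable [IsNoetherianRing S]

theorem isDomain_quotient (h : IsRegularParameterPair x y) : IsDomain (S ⧸ Ideal.span {x}) := by
  have := h.isLocalRing_quotient
  have hm := h.maximalIdeal_quotient
  refine isDomain_of_isPrime_span_singleton (t := Ideal.Quotient.mk _ y)
    (hm ▸ Ideal.mem_span_singleton_self _) ?_ (hm ▸ inferInstance)
  intro u hu
  obtain ⟨u, rfl⟩ := Ideal.Quotient.mk_surjective u
  rw [← map_mul, Ideal.Quotient.eq_zero_iff_mem, Ideal.mem_span_singleton] at hu
  rw [Ideal.Quotient.eq_zero_iff_mem, Ideal.mem_span_singleton]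
  exact h.regular_right _ hu

theorem isPrincipalIdealRing_quotient (h : IsRegularParameterPair x y) :
    IsPrincipalIdealRing (S ⧸ Ideal.span {x}) := by
  have := h.isLocalRing_quotient
  have := h.isDomain_quotient
  have hp : Submodule.IsPrincipal (maximalIdeal (S ⧸ Ideal.span {x})) :=
    ⟨⟨_, h.maximalIdeal_quotient⟩⟩
  exact ((tfae_of_isNoetherianRing_of_isLocalRing_of_isDomain (S ⧸ Ideal.span {x})).out 0 4).2 hp

theorem isDomain (h : IsRegularParameterPair x y) : IsDomain S :=
  isDomain_of_isPrime_span_singleton h.left_mem h.regular_left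
    ((Ideal.Quotient.isDomain_iff_prime _).1 h.isDomain_quotient)

omit [IsNoetherianRing S] in
theorem isRegular (h : IsRegularParameterPair x y) : RingTheory.Sequence.IsRegular S [x, y] :=
  isRegular_pair_of_forall h.left_mem h.right_mem h.regular_left h.regular_right

theorem ringKrullDim_eq_two (h : IsRegularParameterPair x y) : ringKrullDim S = 2 := by
  have h1 := ringKrullDim_add_length_eq_ringKrullDim_of_isRegular [x, y] h.isRegular
  have h2 : Ideal.ofList [x, y] = maximalIdeal S := by
    rw [← h.span_eq, Ideal.ofList]; congr 1; ext; simp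
  rw [h2, ringKrullDim_eq_zero_of_isField ((Ideal.Quotient.maximal_ideal_iff_isField_quotient _).1 inferInstance)] at h1
  rw [← h1]; rfl

theorem isRegularLocalRing (h : IsRegularParameterPair x y) : IsRegularLocalRing S := by
  apply IsRegularLocalRing.of_spanFinrank_maximalIdeal_le
  rw [h.ringKrullDim_eq_two, ← h.span_eq]
  have h1 := Submodule.spanFinrank_span_le_ncard_of_finite (R := S) (Set.toFinite {x, y})
  have h2 : ({x, y} : Set S).ncard ≤ 2 := by
    simpa using Set.ncard_insert_le x {y}
  exact_mod_cast h1.trans h2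

/-- The relations between `f` and `g` form a cyclic module if `x` does not divide `f`. -/
theorem exists_generator_of_not_dvd (h : IsRegularParameterPair x y) {f g : S} (hf : ¬ x ∣ f) :
    ∃ p₀ q₀, p₀ * f = q₀ * g ∧
      ∀ p q, p * f = q * g → ∃ t, p = t * p₀ ∧ q = t * q₀ := by
  have := h.isDomain
  have := h.isDomain_quotient
  have := h.isPrincipalIdealRing_quotient
  let π := Ideal.Quotient.mk (Ideal.span {x})
  have hπ : ∀ s, π s = 0 ↔ x ∣ s := fun s => by
    rw [Ideal.Quotient.eq_zero_iff_mem, Ideal.mem_span_singleton]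
  have hx0 : x ≠ 0 := fun h0 => one_ne_zero (h.regular_left 1 (by simp [h0]))
  let L : Submodule S (S × S) :=
    LinearMap.ker (LinearMap.coprod (LinearMap.mulRight S f) (-LinearMap.mulRight S g))
  have hL : ∀ z : S × S, z ∈ L ↔ z.1 * f = z.2 * g := fun z => by
    simp [L, LinearMap.mem_ker, ← sub_eq_add_neg, sub_eq_zero]
  -- Modulo `x` the second entries of relations form a principal ideal; lift a generator to a
  -- relation. Because `f` is nonzero in the domain `S/(x)`, the second entry modulo `x` determines
  -- the first, so Nakayama shows that this relation generates `L`.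
  let J : Ideal S := L.map (LinearMap.snd S S S)
  obtain ⟨c, hc⟩ := IsPrincipalIdealRing.principal (J.map π)
  have hcm : c ∈ J.map π := hc ▸ Submodule.mem_span_singleton_self c
  rw [Ideal.mem_map_iff_of_surjective _ Ideal.Quotient.mk_surjective] at hcm
  obtain ⟨q₀, hq₀, hqc⟩ := hcm
  obtain ⟨⟨p₀, q₀'⟩, hpq, rfl⟩ := hq₀
  simp only [LinearMap.snd_apply] at hqc
  have hspan : L ≤ Submodule.span S {(p₀, q₀')} := by
    refine Submodule.le_of_le_smul_of_le_jacobson_bot (I := Ideal.span {x})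
      (IsNoetherian.noetherian _) ?_ ?_
    · rw [IsLocalRing.jacobson_eq_maximalIdeal _ bot_ne_top, Ideal.span_singleton_le_iff_mem]
      exact h.left_mem
    · rintro ⟨p, q⟩ hpq'
      have hq : π q ∈ J.map π := Ideal.mem_map_of_mem _ ⟨_, hpq', rfl⟩
      rw [hc] at hq
      obtain ⟨t, ht⟩ := Submodule.mem_span_singleton.1 hq
      obtain ⟨t, rfl⟩ := Ideal.Quotient.mk_surjective t
      have hdiff := L.sub_mem hpq' (L.smul_mem t hpq)
      have hd2 : x ∣ q - t * q₀' := by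
        rw [← hπ, map_sub, map_mul, hqc, ← ht, smul_eq_mul, sub_self]
      have hd1 : x ∣ p - t * p₀ := by
        have he := (hL _).1 hdiff
        simp only [Prod.smul_mk, Prod.mk_sub_mk, smul_eq_mul] at he
        have : π (p - t * p₀) * π f = 0 := by
          rw [← map_mul, he, map_mul, (hπ _).2 hd2, zero_mul]
        exact (hπ _).1 ((mul_eq_zero.1 this).resolve_right (by rwa [hπ]))
      obtain ⟨r, hr⟩ := hd1
      obtain ⟨s, hs⟩ := hd2
      have hrs : (r, s) ∈ L := by
        rw [hL] at hdiff ⊢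
        simp only [Prod.smul_mk, Prod.mk_sub_mk, smul_eq_mul, hr, hs] at hdiff
        exact mul_left_cancel₀ hx0 (by linear_combination hdiff)
      have heq : (p, q) = t • (p₀, q₀') + x • (r, s) := by
        simp only [Prod.smul_mk, smul_eq_mul, Prod.mk_add_mk, ← hr, ← hs]
        ext <;> simp
      rw [heq]
      exact Submodule.add_mem_sup (Submodule.smul_mem _ _ (Submodule.mem_span_singleton_self _))
        (Submodule.smul_mem_smul (Ideal.mem_span_singleton_self x) hrs)
  refine ⟨p₀, q₀', (hL _).1 hpq, fun p q hpq' => ?_⟩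
  obtain ⟨t, ht⟩ := Submodule.mem_span_singleton.1 (hspan ((hL (p, q)).2 hpq'))
  simp only [Prod.smul_mk, smul_eq_mul, Prod.mk.injEq] at ht
  exact ⟨t, ht.1.symm, ht.2.symm⟩

/-- Cancelling the common power of `x` does not change the relations, and afterwards `x` fails to
divide one of the two elements. -/
theorem exists_generator (h : IsRegularParameterPair x y) {f g : S} (hfg : f ≠ 0 ∨ g ≠ 0) :
    ∃ p₀ q₀, p₀ * f = q₀ * g ∧
      ∀ p q, p * f = q * g → ∃ t, p = t * p₀ ∧ q = t * q₀ := by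
  have := h.isDomain
  have hx0 : x ≠ 0 := fun h0 => one_ne_zero (h.regular_left 1 (by simp [h0]))
  obtain ⟨n, f', g', rfl, rfl, hnd⟩ :
      ∃ (n : ℕ) (f' g' : S), f = x ^ n * f' ∧ g = x ^ n * g' ∧ (¬ x ∣ f' ∨ ¬ x ∣ g') := by
    rcases eq_or_ne f 0 with rfl | hf
    · obtain ⟨n, u, rfl, hu⟩ := exists_eq_mul_pow_not_dvd h.left_mem (hfg.resolve_left (by simp))
      exact ⟨n, 0, u, by simp, by ring, .inr hu⟩
    rcases eq_or_ne g 0 with rfl | hg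
    · obtain ⟨n, u, rfl, hu⟩ := exists_eq_mul_pow_not_dvd h.left_mem hf
      exact ⟨n, u, 0, by ring, by simp, .inl hu⟩
    obtain ⟨n, u, rfl, hu⟩ := exists_eq_mul_pow_not_dvd h.left_mem hf
    obtain ⟨m, v, rfl, hv⟩ := exists_eq_mul_pow_not_dvd h.left_mem hg
    rcases le_total n m with hnm | hnm
    · obtain ⟨k, rfl⟩ := Nat.exists_eq_add_of_le hnm
      exact ⟨n, u, v * x ^ k, by ring, by ring, .inl hu⟩
    · obtain ⟨k, rfl⟩ := Nat.exists_eq_add_of_le hnm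
      exact ⟨m, u * x ^ k, v, by ring, by ring, .inr hv⟩
  have key : ∀ p q, p * (x ^ n * f') = q * (x ^ n * g') ↔ p * f' = q * g' := fun p q => by
    rw [mul_left_comm, mul_left_comm q, mul_right_inj' (pow_ne_zero n hx0)]
  simp only [key]
  rcases hnd with hf | hg
  · exact h.exists_generator_of_not_dvd hf
  · obtain ⟨q₀, p₀, h0, hgen⟩ := h.exists_generator_of_not_dvd (f := g') (g := f') hg
    refine ⟨p₀, q₀, h0.symm, fun p q hpq => ?_⟩
    obtain ⟨t, h1, h2⟩ := hgen q p hpq.symm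
    exact ⟨t, h2, h1⟩

/-- Existence of greatest common divisors in a regular local ring of dimension two. -/
theorem exists_gcd (h : IsRegularParameterPair x y) {f g : S} (hfg : f ≠ 0 ∨ g ≠ 0) :
    ∃ d f' g', f = d * f' ∧ g = d * g' ∧ HasKoszulSyzygies f' g' := by
  have := h.isDomain
  obtain ⟨p₀, q₀, h0, hgen⟩ := h.exists_generator hfg
  -- The gcd is the factor by which the trivial relation `g * f = f * g` exceeds the generating
  -- relation.
  obtain ⟨d, h1, h2⟩ := hgen g f (mul_comm _ _)
  refine ⟨d, q₀, p₀, h2, h1, fun p q hpq => hgen p q ?_⟩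
  rw [h1, h2]; linear_combination d * hpq

/-- Divide both elements by their gcd `k`. If `k = k₁x + k₂y` is a nonunit, the rows `(a, b)` and
`(c, d)` are `f'(k₁, k₂)` and `g'(k₁, k₂)` up to multiples `t, s` of `(y, -x)`; expanding gives the
determinant as `-s` times the first element plus `t` times the second. -/
theorem hasKoszulSyzygies_or_det_mem (h : IsRegularParameterPair x y) (a b c d : S) :
    HasKoszulSyzygies (a * x + b * y) (c * x + d * y) ∨
      a * d - b * c ∈ Ideal.span {a * x + b * y, c * x + d * y} := by
  have := h.isDomain
  by_cases hfg : a * x + b * y = 0 ∧ c * x + d * y = 0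
  · right
    obtain ⟨t, rfl, rfl⟩ := h.exists_of_relation hfg.1
    obtain ⟨s, rfl, rfl⟩ := h.exists_of_relation hfg.2
    have : t * y * -(s * x) - -(t * x) * (s * y) = 0 := by ring
    rw [this]
    exact zero_mem _
  obtain ⟨k, f', g', hf, hg, hreg⟩ := h.exists_gcd (not_and_or.1 hfg)
  by_cases hk : IsUnit k
  · left
    obtain ⟨k, rfl⟩ := hk
    intro p q hpq
    rw [hf, hg] at hpq
    obtain ⟨t, rfl, rfl⟩ := hreg p q (k.isUnit.mul_left_cancel (by linear_combination hpq))
    refine ⟨t * ↑k⁻¹, ?_, ?_⟩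
    · rw [hg]; linear_combination -(t * g') * k.inv_mul
    · rw [hf]; linear_combination -(t * f') * k.inv_mul
  · right
    obtain ⟨k₁, k₂, rfl⟩ := h.exists_of_mem ((mem_maximalIdeal _).2 hk)
    obtain ⟨t, h1, h2⟩ := h.exists_of_relation
      (a := a - k₁ * f') (b := b - k₂ * f') (by linear_combination hf)
    obtain ⟨s, h3, h4⟩ := h.exists_of_relation
      (a := c - k₁ * g') (b := d - k₂ * g') (by linear_combination hg)
    obtain rfl := sub_eq_iff_eq_add.1 h1
    obtain rfl := sub_eq_iff_eq_add.1 h2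
    obtain rfl := sub_eq_iff_eq_add.1 h3
    obtain rfl := sub_eq_iff_eq_add.1 h4
    rw [Ideal.mem_span_pair]
    exact ⟨-s, t, by ring⟩

/-- The socle of `S / (f, g)` is generated by the determinant of a matrix expressing `f, g` in
terms of `x, y`. -/
theorem exists_of_mul_mem (h : IsRegularParameterPair x y) {a b c d s : S}
    (hreg : HasKoszulSyzygies (a * x + b * y) (c * x + d * y))
    (hx : s * x ∈ Ideal.span {a * x + b * y, c * x + d * y})
    (hy : s * y ∈ Ideal.span {a * x + b * y, c * x + d * y}) :
    ∃ t, s - t * (a * d - b * c) ∈ Ideal.span {a * x + b * y, c * x + d * y} := by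
  have := h.isDomain
  have hx0 : x ≠ 0 := fun h0 => one_ne_zero (h.regular_left 1 (by simp [h0]))
  obtain ⟨α, β, h1⟩ := Ideal.mem_span_pair.1 hx
  obtain ⟨γ, δ, h2⟩ := Ideal.mem_span_pair.1 hy
  -- Computing `s * x * y` in two ways gives a relation between the two generators; its Koszul
  -- multiplier is the required `t`.
  obtain ⟨t, h3, h4⟩ := hreg (y * α - x * γ) (x * δ - y * β)
    (by linear_combination y * h1 - x * h2)
  obtain ⟨u, h5, h6⟩ := h.exists_of_relation (a := -(γ + t * c)) (b := α - t * d)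
    (by linear_combination h3)
  obtain ⟨v, h7, h8⟩ := h.exists_of_relation (a := δ - t * a) (b := -(β + t * b))
    (by linear_combination h4)
  refine ⟨t, Ideal.mem_span_pair.2 ⟨-u, v, mul_right_cancel₀ hx0 ?_⟩⟩
  linear_combination h1 - (a * x + b * y) * h6 + (c * x + d * y) * h8

omit [IsNoetherianRing S] in
theorem ne_zero_of_hasKoszulSyzygies [IsDomain S] {f g : S} (hg : g ∈ maximalIdeal S)
    (hreg : HasKoszulSyzygies f g) : f ≠ 0 := by
  rintro rfl
  obtain ⟨t, ht, -⟩ := hreg 1 0 (by simp)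
  exact (mem_maximalIdeal _).1 hg (IsUnit.of_mul_eq_one t (by rw [mul_comm]; exact ht.symm))

omit [IsNoetherianRing S] in
theorem isRegular_of_hasKoszulSyzygies [IsDomain S] {f g : S} (hf : f ∈ maximalIdeal S)
    (hg : g ∈ maximalIdeal S) (hreg : HasKoszulSyzygies f g) :
    RingTheory.Sequence.IsRegular S [f, g] :=
  isRegular_pair_of_forall hf hg
    (fun _ hu => (mul_eq_zero.1 hu).resolve_left (ne_zero_of_hasKoszulSyzygies hg hreg))
    fun u ⟨p, hp⟩ => by
      obtain ⟨t, -, ht⟩ := hreg p u (by linear_combination -hp)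
      exact ⟨t, by rw [ht, mul_comm]⟩

theorem exists_pow_le_span_pair (h : IsRegularParameterPair x y) {f g : S}
    (hf : f ∈ maximalIdeal S) (hg : g ∈ maximalIdeal S) (hreg : HasKoszulSyzygies f g) :
    ∃ n : ℕ, maximalIdeal S ^ n ≤ Ideal.span {f, g} := by
  have := h.isDomain
  have hr := isRegular_of_hasKoszulSyzygies hf hg hreg
  have h1 := ringKrullDim_add_length_eq_ringKrullDim_of_isRegular [f, g] hr
  have h2 : Ideal.ofList [f, g] = Ideal.span {f, g} := by
    rw [Ideal.ofList]; congr 1; ext; simp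
  rw [h.ringKrullDim_eq_two, h2] at h1
  have hle : Ideal.span {f, g} ≤ maximalIdeal S := by
    rw [Ideal.span_le]; rintro z (rfl | rfl) <;> assumption
  have : Nontrivial (S ⧸ Ideal.span {f, g}) := Ideal.Quotient.nontrivial_iff.2
    (fun ht => (maximalIdeal.isMaximal S).ne_top (top_le_iff.1 (ht ▸ hle)))
  have : IsLocalRing (S ⧸ Ideal.span {f, g}) :=
    IsLocalRing.of_surjective' _ Ideal.Quotient.mk_surjective
  have h0 : ringKrullDim (S ⧸ Ideal.span {f, g}) ≤ 0 := by
    revert h1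
    generalize ringKrullDim (S ⧸ Ideal.span {f, g}) = e
    intro h1
    induction e using WithBot.recBotCoe with
    | bot => exact bot_le
    | coe e =>
      have h2 : ((e + 2 : ℕ∞) : WithBot ℕ∞) = ((2 : ℕ∞) : WithBot ℕ∞) := h1
      have h3 : e + 2 ≤ 0 + 2 := by rw [WithBot.coe_injective h2, zero_add]
      exact_mod_cast (ENat.add_le_add_iff_right (by simp)).1 h3
  have hdim : Ring.KrullDimLE 0 (S ⧸ Ideal.span {f, g}) := Ring.krullDimLE_iff.2 (by simpa using h0)
  have hart : IsArtinianRing (S ⧸ Ideal.span {f, g}) :=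
    isArtinianRing_iff_isNoetherianRing_krullDimLE_zero.2 ⟨inferInstance, hdim⟩
  obtain ⟨n, hn⟩ := IsArtinianRing.isNilpotent_jacobson_bot (R := S ⧸ Ideal.span {f, g})
  refine ⟨n, ?_⟩
  rw [IsLocalRing.jacobson_eq_maximalIdeal _ bot_ne_top,
    ← IsLocalRing.map_maximalIdeal_of_surjective _ (Ideal.Quotient.mk_surjective
      (I := Ideal.span {f, g})), ← Ideal.map_pow, Submodule.zero_eq_bot,
    Ideal.map_eq_bot_iff_le_ker, Ideal.mk_ker] at hn
  exact hn

/-- In `S / (f, g)` the socle generator lies in every nonzero ideal. -/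
theorem det_mem_of_not_le (h : IsRegularParameterPair x y) {a b c d : S}
    (hf : a * x + b * y ∈ maximalIdeal S) (hg : c * x + d * y ∈ maximalIdeal S)
    (hreg : HasKoszulSyzygies (a * x + b * y) (c * x + d * y))
    {J : Ideal S} (hJ : ¬ J ≤ Ideal.span {a * x + b * y, c * x + d * y}) :
    a * d - b * c ∈ J ⊔ Ideal.span {a * x + b * y, c * x + d * y} := by
  set I := Ideal.span {a * x + b * y, c * x + d * y} with hI
  obtain ⟨n, hn⟩ := h.exists_pow_le_span_pair hf hg hreg
  -- For the least such exponent, the preceding power times `J` contains an element outside `I` that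
  -- the maximal ideal multiplies into `I`: a nonzero socle element of `S/I` coming from `J`.
  have hex : ∃ k : ℕ, maximalIdeal S ^ k * J ≤ I := ⟨n, Ideal.mul_le_left.trans hn⟩
  classical
  obtain ⟨k, hk⟩ := Nat.exists_eq_succ_of_ne_zero (n := Nat.find hex) (by
    intro h0
    have := Nat.find_spec hex
    rw [h0] at this
    exact hJ (by simpa using this))
  have hlt : ¬ maximalIdeal S ^ k * J ≤ I := Nat.find_min hex (by omega)
  have hle : maximalIdeal S ^ (k + 1) * J ≤ I := by rw [← Nat.succ_eq_add_one, ← hk]; exact Nat.find_spec hex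
  obtain ⟨s, hs, hsI⟩ := SetLike.not_le_iff_exists.1 hlt
  have hms : ∀ z ∈ maximalIdeal S, s * z ∈ I := fun z hz => hle (by
    rw [pow_succ', mul_assoc, mul_comm s]; exact Ideal.mul_mem_mul hz hs)
  obtain ⟨t, ht⟩ := h.exists_of_mul_mem hreg (hms x h.left_mem) (hms y h.right_mem)
  have hdet : ∀ z ∈ maximalIdeal S, z * (a * d - b * c) ∈ I := by
    intro z hz
    obtain ⟨z₁, z₂, rfl⟩ := h.exists_of_mem hz
    exact Ideal.mem_span_pair.2 ⟨z₁ * d - z₂ * c, z₂ * a - z₁ * b, by ring⟩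
  -- By Cramer's rule the maximal ideal multiplies the determinant into `I`, so a nonunit `t` would
  -- put `s` in `I`.
  have htu : IsUnit t := by
    by_contra htu
    exact hsI (by simpa using I.add_mem ht (hdet t ((mem_maximalIdeal _).2 htu)))
  obtain ⟨t, rfl⟩ := htu
  have hsJ : s ∈ J := Ideal.mul_le_right hs
  have : a * d - b * c = ↑t⁻¹ * s - ↑t⁻¹ * (s - t * (a * d - b * c)) := by
    linear_combination (-(a * d - b * c)) * t.inv_mul
  rw [this]
  exact Ideal.sub_mem _ (Ideal.mem_sup_left (J.mul_mem_left _ hsJ))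
    (Ideal.mem_sup_right (I.mul_mem_left _ ht))

end IsRegularParameterPair

/-! ### From a presentation by a regular ring to a complete intersection. -/

theorem IsLocalRing.isAdicComplete_of_pow_eq_bot {R : Type*} [CommRing R] {I : Ideal R} {n : ℕ}
    (hn : I ^ n = ⊥) : IsAdicComplete I R := by
  have hz : ∀ m, n ≤ m → (I ^ m • ⊤ : Submodule R R) = ⊥ := fun m hm => by
    rw [smul_eq_mul, Ideal.mul_top]
    exact le_bot_iff.1 (hn ▸ Ideal.pow_le_pow_right hm)
  exact
  { haus' := fun x hx => by
      have := hx n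
      rw [hz n le_rfl] at this
      simpa [SModEq.zero] using this
    prec' := fun f hf => by
      refine ⟨f n, fun m => ?_⟩
      rcases le_total m n with h | h
      · exact hf h
      · have := hf h
        rw [hz n le_rfl, SModEq.bot] at this
        rw [this] }

/-- A presentation of a local ring with maximal ideal `(x, y)` by a two-dimensional regular local
ring. -/
theorem IsRegularParameterPair.exists_isRegular_ker_eq {S R : Type*} [CommRing S] [IsLocalRing S]
    [IsNoetherianRing S] [CommRing R] [IsLocalRing R] {X Y : S} (h : IsRegularParameterPair X Y)
    (φ : S →+* R) (hφ : Function.Surjective φ) {a b c d : R}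
    (h1 : a * φ X + b * φ Y = 0) (h2 : c * φ X + d * φ Y = 0) (hne : a * d - b * c ≠ 0) :
    ∃ f g, RingTheory.Sequence.IsRegular S [f, g] ∧ RingHom.ker φ = Ideal.ofList [f, g] ∧
      ∀ J : Ideal R, J ≠ ⊥ → a * d - b * c ∈ J := by
  have := h.isDomain
  obtain ⟨a, rfl⟩ := hφ a
  obtain ⟨b, rfl⟩ := hφ b
  obtain ⟨c, rfl⟩ := hφ c
  obtain ⟨d, rfl⟩ := hφ d
  have hI : RingHom.ker φ ≤ maximalIdeal S := le_maximalIdeal (RingHom.ker_ne_top φ)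
  have hf : a * X + b * Y ∈ RingHom.ker φ := by simpa [RingHom.mem_ker] using h1
  have hg : c * X + d * Y ∈ RingHom.ker φ := by simpa [RingHom.mem_ker] using h2
  have hle : Ideal.span {a * X + b * Y, c * X + d * Y} ≤ RingHom.ker φ := by
    rw [Ideal.span_le]; rintro z (rfl | rfl) <;> assumption
  have hdet : a * d - b * c ∉ RingHom.ker φ := by
    rw [RingHom.mem_ker]; simpa using hne
  have hreg := (h.hasKoszulSyzygies_or_det_mem a b c d).resolve_right fun hh => hdet (hle hh)
  have key : ∀ J : Ideal S, ¬ J ≤ Ideal.span {a * X + b * Y, c * X + d * Y} → 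
      a * d - b * c ∈ J ⊔ Ideal.span {a * X + b * Y, c * X + d * Y} :=
    fun J hJ => h.det_mem_of_not_le (hI hf) (hI hg) hreg hJ
  have hker : RingHom.ker φ = Ideal.span {a * X + b * Y, c * X + d * Y} := by
    refine le_antisymm ?_ hle
    -- A kernel larger than `(f, g)` would contain the socle generator, which is the determinant.
    by_contra hcon
    have := key _ hcon
    rw [sup_eq_left.2 hle] at this
    exact hdet this
  refine ⟨a * X + b * Y, c * X + d * Y,
    IsRegularParameterPair.isRegular_of_hasKoszulSyzygies (hI hf) (hI hg) hreg, ?_, ?_⟩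
  · rw [hker, Ideal.ofList]; congr 1; ext; simp
  · intro J hJ
    obtain ⟨z, hz, hz0⟩ := Submodule.exists_mem_ne_zero_of_ne_bot hJ
    obtain ⟨z, rfl⟩ := hφ z
    have := key (J.comap φ) (fun hh => hz0 (hker.ge (hh hz)))
    rw [sup_eq_left.2 (hker ▸ Ideal.comap_mono bot_le)] at this
    simpa using this

theorem IsLocalRing.isCompleteIntersection_of_relations.{u} {S R : Type u} [CommRing S]
    [IsLocalRing S]
    [IsNoetherianRing S] [CommRing R] [IsLocalRing R] {X Y : S} (h : IsRegularParameterPair X Y)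
    (φ : S →+* R) (hφ : Function.Surjective φ) {n : ℕ} (hn : maximalIdeal R ^ n = ⊥)
    {a b c d : R} (h1 : a * φ X + b * φ Y = 0) (h2 : c * φ X + d * φ Y = 0)
    (hne : a * d - b * c ≠ 0) : IsCompleteIntersectionLocalRing R := by
  obtain ⟨f, g, hreg, hker, -⟩ := h.exists_isRegular_ker_eq φ hφ h1 h2 hne
  have := isAdicComplete_of_pow_eq_bot hn
  have hb := AdicCompletion.of_bijective (maximalIdeal R) R
  have hb' : Function.Bijective (algebraMap R (AdicCompletion (maximalIdeal R) R)) := by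
    convert! hb using 1
  refine ⟨S, inferInstance, h.isRegularLocalRing,
    (algebraMap R (AdicCompletion (maximalIdeal R) R)).comp φ, [f, g], ?_, hreg, ?_⟩
  · rw [RingHom.coe_comp]; exact hb'.2.comp hφ
  · rw [← hker, RingHom.ker_comp_of_injective _ hb'.1]

/-! ### Unramified subrings of a local domain with prescribed residues. -/

section
variable {O : Type*} [CommRing O]

/-- Every monic polynomial splits into linear factors over `O`, so `x` is the image of one of its
roots. -/
theorem Polynomial.exists_root_lift [IsDomain O] {L : Type*} [Field L] (ρ : O →+* L)
    (hroot : ∀ f : O[X], f.Monic → 0 < f.natDegree → ∃ t, f.eval t = 0) {x : L} :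
    ∀ f : O[X], f.Monic → f.eval₂ ρ x = 0 → ∃ t, f.eval t = 0 ∧ ρ t = x := by
  suffices h : ∀ (n : ℕ) (f : O[X]), f.natDegree = n → f.Monic → f.eval₂ ρ x = 0 →
      ∃ t, f.eval t = 0 ∧ ρ t = x from fun f => h _ f rfl
  intro n
  induction n with
  | zero =>
    intro f hn hf h0
    rw [hf.natDegree_eq_zero.1 hn] at h0
    simp at h0
  | succ n ih =>
    intro f hn hf h0
    obtain ⟨t, ht⟩ := hroot f hf (by omega)
    obtain ⟨g, rfl⟩ := dvd_iff_isRoot.2 ht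
    have hg : g.Monic := (monic_X_sub_C t).of_mul_monic_left hf
    rw [(monic_X_sub_C t).natDegree_mul hg, natDegree_X_sub_C] at hn
    rw [eval₂_mul, eval₂_sub, eval₂_X, eval₂_C, mul_eq_zero] at h0
    rcases h0 with h0 | h0
    · exact ⟨t, ht, (sub_eq_zero.1 h0).symm⟩
    · obtain ⟨s, hs, hsx⟩ := ih g (by omega) hg h0
      exact ⟨s, by simp [hs], hsx⟩

variable [IsLocalRing O]

/-- A subring of a local domain on which `p` behaves like a uniformizer and whose residues lie in
a given subfield. -/
structure IsUnramifiedSubring (p : O) (k : Subfield (ResidueField O)) (V : Subring O) : Prop where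
  exists_of_residue_eq_zero : ∀ v ∈ V, residue O v = 0 → ∃ w ∈ V, v = p * w
  eq_zero_of_forall_dvd : ∀ v ∈ V, (∀ n : ℕ, p ^ n ∣ v) → v = 0
  residue_mem : ∀ v ∈ V, residue O v ∈ k

namespace IsUnramifiedSubring

variable {p : O} {k : Subfield (ResidueField O)} {V : Subring O}

theorem sSup {c : Set (Subring O)} (hc : ∀ V ∈ c, IsUnramifiedSubring p k V)
    (hchain : IsChain (· ≤ ·) c) (hne : c.Nonempty) : IsUnramifiedSubring p k (sSup c) := by
  have hmem := fun v => Subring.mem_sSup_of_directedOn (x := v) hne hchain.directedOn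
  refine ⟨fun v hv h0 => ?_, fun v hv h0 => ?_, fun v hv => ?_⟩ <;>
    obtain ⟨V, hV, hvV⟩ := (hmem v).1 hv
  · obtain ⟨w, hw, rfl⟩ := (hc V hV).1 v hvV h0
    exact ⟨w, (hmem w).2 ⟨V, hV, hw⟩, rfl⟩
  · exact (hc V hV).2 v hvV h0
  · exact (hc V hV).3 v hvV

/-- The subring of `O` generated by `V` and the inverses of the elements of `V` that are units
in `O`. -/
def unitFractions (V : Subring O) : Subring O where
  carrier := {o | ∃ u ∈ V, ∃ v ∈ V, residue O v ≠ 0 ∧ v * o = u}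
  mul_mem' := by
    rintro a b ⟨u, hu, v, hv, h0, h⟩ ⟨u', hu', v', hv', h0', h'⟩
    exact ⟨u * u', mul_mem hu hu', v * v', mul_mem hv hv', by simp [h0, h0'], by
      rw [← h, ← h']; ring⟩
  one_mem' := ⟨1, one_mem _, 1, one_mem _, by simp, by simp⟩
  add_mem' := by
    rintro a b ⟨u, hu, v, hv, h0, h⟩ ⟨u', hu', v', hv', h0', h'⟩
    exact ⟨u * v' + v * u', add_mem (mul_mem hu hv') (mul_mem hv hu'), v * v', mul_mem hv hv',
      by simp [h0, h0'], by rw [← h, ← h']; ring⟩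
  zero_mem' := ⟨0, zero_mem _, 1, one_mem _, by simp, by simp⟩
  neg_mem' := by
    rintro a ⟨u, hu, v, hv, h0, h⟩
    exact ⟨-u, neg_mem hu, v, hv, h0, by rw [← h]; ring⟩

theorem le_unitFractions : V ≤ unitFractions V :=
  fun v hv => ⟨v, hv, 1, one_mem _, by simp, by simp⟩

variable [IsDomain O]

/-- Used to see that a maximal unramified subring contains the inverses of its elements of nonzero
residue. -/
theorem unitFractions_of (h : IsUnramifiedSubring p k V) :
    IsUnramifiedSubring p k (unitFractions V) := by
  refine ⟨?_, ?_, ?_⟩ <;> rintro o ⟨u, hu, v, hv, hv0, huv⟩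
  · intro h0
    obtain ⟨w, hw, hw'⟩ := h.1 u hu (by rw [← huv, map_mul, h0, mul_zero])
    obtain ⟨v', rfl⟩ : IsUnit v := by
      by_contra hcon
      exact hv0 ((residue_eq_zero_iff _).2 ((mem_maximalIdeal _).2 hcon))
    refine ⟨↑v'⁻¹ * w, ⟨w, hw, v', hv, hv0, by simp⟩, ?_⟩
    rw [mul_left_comm, ← hw', ← huv, v'.inv_mul_cancel_left]
  · intro h0
    have := h.2 u hu fun n => huv ▸ (h0 n).mul_left v
    rw [← huv, mul_eq_zero] at this
    exact this.resolve_left fun h => hv0 (by simp [h])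
  · have : residue O o = residue O u / residue O v := by
      rw [← huv, map_mul, mul_div_cancel_left₀ _ hv0]
    rw [this]
    exact div_mem (h.3 u hu) (h.3 v hv)

/-- Adjoining `t` keeps a subring unramified if polynomials over `V` can be normalised so that the
ones vanishing at the residue of `t` have zero residue. -/
theorem adjoin (h : IsUnramifiedSubring p k V) (hpV : p ∈ V) (hp : p ≠ 0)
    (hp0 : residue O p = 0) {t : O} (ht : residue O t ∈ k) (H : Set V[X])
    (hH : ∀ f : V[X], ∃ g ∈ H, g.eval₂ V.subtype t = f.eval₂ V.subtype t)
    (hdiv : ∀ f : V[X], C ⟨p, hpV⟩ * f ∈ H → f ∈ H)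
    (hvan : ∀ f ∈ H, residue O (f.eval₂ V.subtype t) = 0 →
      ∀ i, residue O (f.coeff i) = 0) :
    IsUnramifiedSubring p k (eval₂RingHom V.subtype t).range := by
  have step : ∀ f ∈ H, residue O (f.eval₂ V.subtype t) = 0 →
      ∃ g ∈ H, f = C ⟨p, hpV⟩ * g := by
    intro f hf h0
    have hd : C (⟨p, hpV⟩ : V) ∣ f := by
      rw [C_dvd_iff_dvd_coeff]
      intro i
      obtain ⟨w, hw, hw'⟩ := h.1 _ (f.coeff i).2 (hvan f hf h0 i)
      exact ⟨⟨w, hw⟩, Subtype.ext hw'⟩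
    obtain ⟨g, rfl⟩ := hd
    exact ⟨g, hdiv g hf, rfl⟩
  refine ⟨?_, ?_, ?_⟩ <;> rintro _ ⟨f, rfl⟩ <;> obtain ⟨g, hg, hgf⟩ := hH f <;>
    simp only [coe_eval₂RingHom] at * <;> rw [← hgf]
  · intro h0
    obtain ⟨q, hq, rfl⟩ := step g hg h0
    exact ⟨_, ⟨q, rfl⟩, by simp⟩
  · intro h0
    -- A value divisible by all powers of `p` lets `p` be divided out of the normal form
    -- indefinitely, so its coefficients are divisible by every power of `p` and vanish.
    have hn : ∀ n : ℕ, ∃ q ∈ H, g = C (⟨p, hpV⟩ ^ n : V) * q := by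
      intro n
      induction n with
      | zero => exact ⟨g, hg, by simp⟩
      | succ n ih =>
        obtain ⟨q, hq, rfl⟩ := ih
        have hd := h0 (n + 1)
        simp only [eval₂_mul, eval₂_C, Subring.subtype_apply, SubmonoidClass.mk_pow] at hd
        rw [pow_succ, mul_dvd_mul_iff_left (pow_ne_zero n hp)] at hd
        obtain ⟨q', hq', rfl⟩ := step q hq (by
          obtain ⟨r, hr⟩ := hd
          rw [hr, map_mul, hp0, zero_mul])
        exact ⟨q', hq', by rw [pow_succ, C_mul, mul_assoc]⟩
    have : g = 0 := by
      ext i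
      refine h.2 _ (g.coeff i).2 fun n => ?_
      obtain ⟨q, -, rfl⟩ := hn n
      exact ⟨q.coeff i, by simp⟩
    simp [this]
  · rw [eval₂_eq_sum_range, map_sum]
    refine sum_mem fun i _ => ?_
    rw [map_mul, map_pow]
    exact mul_mem (h.3 _ (g.coeff i).2) (pow_mem ht i)

omit [IsDomain O] [IsLocalRing O] in
theorem mem_range_eval₂ (t : O) : V ≤ (eval₂RingHom V.subtype t).range ∧
    t ∈ (eval₂RingHom V.subtype t).range :=
  ⟨fun v hv => ⟨C ⟨v, hv⟩, by simp⟩, ⟨X, by simp⟩⟩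

/-- A maximal unramified subring has residue field `k`. -/
theorem exists_residue_eq_of_maximal (hV : Maximal (IsUnramifiedSubring p k) V)
    (hroot : ∀ f : O[X], f.Monic → 0 < f.natDegree → ∃ t, f.eval t = 0)
    (hpV : p ∈ V) (hp : p ≠ 0) (hp0 : residue O p = 0) {x : ResidueField O} (hx : x ∈ k) :
    ∃ v ∈ V, residue O v = x := by
  let r : V →+* ResidueField O := (residue O).comp V.subtype
  have hr : ∀ (f : V[X]) (t : O), residue O t = x →
      residue O (f.eval₂ V.subtype t) = f.eval₂ r x := fun f t ht => by
    rw [hom_eval₂, ht]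
  have hpdeg : ∀ f : V[X], (C (⟨p, hpV⟩ : V) * f).degree = f.degree := fun f =>
    degree_C_mul (fun h => hp (congrArg Subtype.val h))
  suffices ∃ t, residue O t = x ∧ IsUnramifiedSubring p k (eval₂RingHom V.subtype t).range by
    obtain ⟨t, ht, h⟩ := this
    exact ⟨t, hV.2 h (mem_range_eval₂ t).1 (mem_range_eval₂ t).2, ht⟩
  -- Whether `x` is algebraic or transcendental over the image of `V`. In the algebraic case take
  -- `f` of least degree with nonzero reduction vanishing at `x`.
  by_cases hex : ∃ f : V[X], f.eval₂ r x = 0 ∧ f.map r ≠ 0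
  · classical
    obtain ⟨f, ⟨hf0, hf1⟩, hmin⟩ :=
      WellFounded.has_min (measure (natDegree (R := V))).wf _ hex
    replace hmin : ∀ g : V[X], g.natDegree < f.natDegree → g.eval₂ r x = 0 → g.map r = 0 :=
      fun g hg h0 => by_contra fun h1 => hmin g ⟨h0, h1⟩ hg
    -- Otherwise erasing the leading term would keep the reduction and lower the degree.
    have hlc : r f.leadingCoeff ≠ 0 := by
      intro h0
      have h1 : f.eraseLead.map r = f.map r := by
        conv_rhs => rw [← eraseLead_add_C_mul_X_pow f]
        rw [Polynomial.map_add, Polynomial.map_mul, map_C, h0, C_0, zero_mul, add_zero]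
      rcases Nat.eq_zero_or_pos f.natDegree with hd | hd
      · rw [eq_C_of_natDegree_eq_zero hd] at hf1
        rw [leadingCoeff, hd] at h0
        simp [h0] at hf1
      · refine hf1 (h1 ▸ hmin _ ((eraseLead_natDegree_le f).trans_lt (by omega)) ?_)
        rw [← eval_map, h1, eval_map, hf0]
    have hu : IsUnit f.leadingCoeff := by
      obtain ⟨u, hu⟩ : IsUnit (f.leadingCoeff : O) := by
        by_contra hcon
        exact hlc ((residue_eq_zero_iff _).2 ((mem_maximalIdeal _).2 hcon))
      have hmem : (↑u⁻¹ : O) ∈ V := hV.2 hV.1.unitFractions_of le_unitFractions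
        ⟨1, one_mem _, f.leadingCoeff, f.leadingCoeff.2, hlc, by rw [← hu]; simp⟩
      exact IsUnit.of_mul_eq_one ⟨_, hmem⟩ (Subtype.ext (by simp [← hu]))
    obtain ⟨u, hu⟩ := hu
    let g := C (↑u⁻¹ : V) * f
    have hg : g.Monic := by
      rw [Monic, leadingCoeff_mul, leadingCoeff_C, ← hu, Units.inv_mul]
    have hdeg : g.natDegree = f.natDegree := natDegree_C_mul u⁻¹.ne_zero
    have hg0 : g.eval₂ r x = 0 := by simp [g, eval₂_mul, hf0]
    -- With `t` an actual root of `g`, division by `g` makes the polynomials of degree below that of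
    -- `g` into normal forms; minimality gives the vanishing condition.
    obtain ⟨t, ht, htx⟩ := exists_root_lift (residue O) hroot (g.map V.subtype) (hg.map _)
      (x := x) (by rw [eval₂_map]; exact hg0)
    rw [eval_map] at ht
    refine ⟨t, htx, hV.1.adjoin hpV hp hp0 (htx ▸ hx) {h | h.degree < g.degree} ?_ ?_ ?_⟩
    · intro h
      refine ⟨h %ₘ g, degree_modByMonic_lt h hg, ?_⟩
      conv_rhs => rw [← modByMonic_add_div h g]
      simp [eval₂_mul, eval₂_add, ht]
    · intro h hh
      simpa only [Set.mem_ofPred_eq, hpdeg] using hh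
    · intro h hh h0 i
      rw [hr _ _ htx] at h0
      by_cases hz : h = 0
      · simp [hz]
      have h1 := hmin h (by rw [← hdeg]; exact natDegree_lt_natDegree hz hh) h0
      have := congrArg (fun q => q.coeff i) h1
      rw [coeff_map, coeff_zero] at this
      exact this
  · push Not at hex
    -- In the transcendental case any lift works, with all polynomials as normal forms.
    obtain ⟨t, ht⟩ := residue_surjective x
    refine ⟨t, ht, hV.1.adjoin hpV hp hp0 (ht ▸ hx) Set.univ (fun f => ⟨f, trivial, rfl⟩)
      (fun _ _ => trivial) fun f _ h0 i => ?_⟩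
    rw [hr _ _ ht] at h0
    have := congrArg (fun q => q.coeff i) (hex f h0)
    rw [coeff_map, coeff_zero] at this
    exact this

theorem castRingHom_range [CharZero O] {q : ℕ} (hq : q.Prime) (hq0 : residue O (q : O) = 0) :
    IsUnramifiedSubring (q : O) k (Int.castRingHom O).range := by
  have : Fact q.Prime := ⟨hq⟩
  have hchar : CharP (ResidueField O) q :=
    (CharP.charP_iff_prime_eq_zero hq).2 (by simpa using hq0)
  have hdvd : ∀ m : ℤ, residue O (m : O) = 0 → (q : ℤ) ∣ m := fun m h0 => by
    rwa [map_intCast, CharP.intCast_eq_zero_iff _ q] at h0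
  have hq1 : (q : O) ≠ 0 := Nat.cast_ne_zero.2 hq.ne_zero
  refine ⟨?_, ?_, ?_⟩ <;> rintro _ ⟨m, rfl⟩ <;> simp only [eq_intCast]
  · intro h0
    obtain ⟨n, rfl⟩ := hdvd m h0
    exact ⟨n, ⟨n, rfl⟩, by simp⟩
  · intro h0
    have key : ∀ (n : ℕ) (m : ℤ), (q : O) ^ n ∣ m → (q : ℤ) ^ n ∣ m := by
      intro n
      induction n with
      | zero => simp
      | succ n ih =>
        intro m hm
        obtain ⟨l, rfl⟩ := hdvd m (by
          obtain ⟨c, hc⟩ := hm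
          rw [hc, pow_succ', mul_assoc, map_mul, hq0, zero_mul])
        rw [pow_succ', Int.cast_mul, Int.cast_natCast, mul_dvd_mul_iff_left hq1] at hm
        rw [pow_succ']
        exact mul_dvd_mul_left _ (ih l hm)
    have hm : m = 0 := by
      refine Int.eq_zero_of_abs_lt_dvd (key m.natAbs m (h0 _)) ?_
      rw [← Int.natCast_natAbs]
      exact_mod_cast Nat.lt_pow_self hq.one_lt
    simp [hm]
  · simp


theorem isDiscreteValuationRing (hV : IsUnramifiedSubring p k V)
    (hunit : ∀ v ∈ V, residue O v ≠ 0 → ∃ w ∈ V, v * w = 1)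
    (hpV : p ∈ V) (hp : p ≠ 0) (hp0 : residue O p = 0) :
    IsDiscreteValuationRing V ∧ ∀ v : V, residue O v = 0 → v ∈ Ideal.span {(⟨p, hpV⟩ : V)} := by
  have hmem : ∀ v : V, residue O v = 0 → ∃ w : V, v = ⟨p, hpV⟩ * w := fun v h0 => by
    obtain ⟨w, hw, h⟩ := hV.1 v v.2 h0
    exact ⟨⟨w, hw⟩, Subtype.ext h⟩
  have hun : ∀ v : V, residue O v ≠ 0 → IsUnit v := fun v h0 => by
    obtain ⟨w, hw, h⟩ := hunit v v.2 h0
    exact IsUnit.of_mul_eq_one ⟨w, hw⟩ (Subtype.ext h)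
  have hpu : ¬ IsUnit (⟨p, hpV⟩ : V) := fun h => by
    have := (h.map (V.subtype)).map (residue O)
    simp [hp0] at this
  refine ⟨IsDiscreteValuationRing.ofHasUnitMulPowIrreducibleFactorization ⟨⟨p, hpV⟩, ?_, ?_⟩,
    fun v h0 => Ideal.mem_span_singleton.2 (hmem v h0)⟩
  · refine ⟨hpu, fun a b hab => ?_⟩
    by_contra! hcon
    have ha := not_imp_comm.1 (hun a) hcon.1
    have hb := not_imp_comm.1 (hun b) hcon.2
    obtain ⟨a', rfl⟩ := hmem a ha
    have h0 : (⟨p, hpV⟩ : V) ≠ 0 := fun h => hp (congrArg Subtype.val h)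
    rw [mul_assoc] at hab
    have h1 := mul_left_cancel₀ h0 ((mul_one _).trans hab)
    exact hcon.2 (IsUnit.of_mul_eq_one a' (by rw [h1, mul_comm]))
  · intro v hv
    have hex : ∃ n : ℕ, ¬ (⟨p, hpV⟩ : V) ^ n ∣ v := by
      by_contra! hcon
      refine hv (Subtype.ext (hV.2 v v.2 fun n => ?_))
      simpa using map_dvd V.subtype (hcon n)
    classical
    obtain ⟨n, hn⟩ := Nat.exists_eq_succ_of_ne_zero (n := Nat.find hex) (by
      intro h0
      have := Nat.find_spec hex
      rw [h0] at this
      simp at this)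
    have hd : (⟨p, hpV⟩ : V) ^ n ∣ v := not_not.1 (Nat.find_min hex (by omega))
    obtain ⟨u, rfl⟩ := hd
    refine ⟨n, ?_⟩
    have hu : IsUnit u := hun u fun h0 => by
      obtain ⟨w, rfl⟩ := hmem u h0
      refine Nat.find_spec hex ?_
      rw [hn]
      exact ⟨w, by rw [pow_succ, mul_assoc]⟩
    obtain ⟨u, rfl⟩ := hu
    exact ⟨u, rfl⟩

theorem exists_isDiscreteValuationRing [CharZero O] {q : ℕ} (hq : q.Prime)
    (hq0 : residue O (q : O) = 0) (k : Subfield (ResidueField O))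
    (hroot : ∀ f : O[X], f.Monic → 0 < f.natDegree → ∃ t, f.eval t = 0) :
    ∃ (V : Subring O) (g : V →+* k), IsDiscreteValuationRing V ∧ Function.Surjective g ∧
      RingHom.ker g = Ideal.span {(q : V)} := by
  obtain ⟨V, hle, hV⟩ := zorn_le_nonempty₀ {V : Subring O | IsUnramifiedSubring (q : O) k V}
    (fun c hc hchain V hV => ⟨_, IsUnramifiedSubring.sSup hc hchain ⟨V, hV⟩,
      fun W hW => le_sSup hW⟩) _ (castRingHom_range hq hq0)
  have hqV : (q : O) ∈ V := natCast_mem V q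
  have hq1 : (q : O) ≠ 0 := Nat.cast_ne_zero.2 hq.ne_zero
  have hunit : ∀ v ∈ V, residue O v ≠ 0 → ∃ w ∈ V, v * w = 1 := by
    intro v hv h0
    obtain ⟨u, rfl⟩ : IsUnit v := by
      by_contra hcon
      exact h0 ((residue_eq_zero_iff _).2 ((mem_maximalIdeal _).2 hcon))
    exact ⟨_, hV.2 hV.1.unitFractions_of le_unitFractions
        ⟨1, one_mem _, u, hv, h0, u.mul_inv⟩, u.mul_inv⟩
  obtain ⟨hdvr, hker⟩ := hV.1.isDiscreteValuationRing hunit hqV hq1 hq0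
  refine ⟨V, ((residue O).comp V.subtype).codRestrict k fun v => hV.1.3 v v.2, hdvr, ?_, ?_⟩
  · rintro ⟨x, hx⟩
    obtain ⟨v, hv, rfl⟩ := exists_residue_eq_of_maximal hV hroot hqV hq1 hq0 hx
    exact ⟨⟨v, hv⟩, rfl⟩
  · refine le_antisymm (fun v hv => hker v (congrArg Subtype.val hv)) ?_
    rw [Ideal.span_le, Set.singleton_subset_iff]
    exact Subtype.ext (by simpa using hq0)

end IsUnramifiedSubring
end

/-! ### Discrete valuation rings of characteristic zero with given residue field. -/

theorem ValuationSubring.exists_root_of_monic {K : Type*} [Field K] [IsAlgClosed K]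
    (A : ValuationSubring K) (f : A[X]) (hf : f.Monic) (h0 : 0 < f.natDegree) :
    ∃ t, f.eval t = 0 := by
  obtain ⟨x, hx⟩ := IsAlgClosed.exists_root (f.map A.subtype) (by
    rw [hf.degree_map]
    exact (natDegree_pos_iff_degree_pos.1 h0).ne')
  have hint : IsIntegral A x := ⟨f, hf, by rwa [IsRoot, eval_map] at hx⟩
  obtain ⟨t, rfl⟩ := IsIntegrallyClosed.isIntegral_iff.1 hint
  refine ⟨t, ?_⟩
  have h1 : A.subtype (f.eval t) = 0 := by
    rw [← eval_map_apply]; exact hx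
  exact (map_eq_zero_iff _ A.subtype_injective).1 h1

/-- Dominate `B` by a valuation ring of an algebraic closure of its fraction field. There monic
polynomials have roots, so Zorn's lemma yields an unramified subring whose residue field is exactly
the image of that of `B`. -/
theorem IsLocalRing.exists_isDiscreteValuationRing.{u} (B : Type u) [CommRing B] [IsDomain B]
    [IsLocalRing B] [CharZero B] {q : ℕ} (hq : q.Prime) (hq0 : residue B (q : B) = 0) :
    ∃ (V : Type u) (_ : CommRing V) (_ : IsDomain V) (_ : IsDiscreteValuationRing V)
      (g : V →+* ResidueField B), (q : V) ≠ 0 ∧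
      Function.Surjective g ∧ RingHom.ker g = Ideal.span {(q : V)} := by
  let K := AlgebraicClosure (FractionRing B)
  let j : B →+* K := (algebraMap (FractionRing B) K).comp (algebraMap B (FractionRing B))
  have hj : Function.Injective j := by
    rw [RingHom.coe_comp]
    exact (algebraMap (FractionRing B) K).injective.comp (IsFractionRing.injective B _)
  obtain ⟨O, hO, hloc⟩ := exists_factor_valuationRing j
  let j' : B →+* O := j.codRestrict O.toSubring hO
  have : IsLocalHom j' := hloc
  have : CharZero O := charZero_of_injective_ringHom (f := j') fun a b hab =>
    hj (congrArg Subtype.val hab)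
  let ι : ResidueField B →+* ResidueField O := ResidueField.map j'
  have hq0' : residue O (q : O) = 0 := by
    rw [map_natCast] at hq0 ⊢
    rw [← map_natCast ι, hq0, map_zero]
  obtain ⟨V, g, hV, hg, hker⟩ := IsUnramifiedSubring.exists_isDiscreteValuationRing hq hq0'
    ι.fieldRange O.exists_root_of_monic
  let e := ι.rangeRestrictFieldEquiv.symm
  refine ⟨V, inferInstance, inferInstance, hV, (e : _ →+* ResidueField B).comp g, ?_, ?_, ?_⟩
  · exact Nat.cast_ne_zero.2 hq.ne_zero
  · exact e.surjective.comp hg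
  · rw [← hker]
    exact RingHom.ker_comp_of_injective _ e.injective

/-- Every field of characteristic `q > 0` is the residue field of an unramified discrete valuation
ring of characteristic zero. -/
theorem Field.exists_isDiscreteValuationRing.{u} (k : Type u) [Field k] {q : ℕ} (hq : q.Prime)
    [CharP k q] :
    ∃ (V : Type u) (_ : CommRing V) (_ : IsDomain V) (_ : IsDiscreteValuationRing V)
      (g : V →+* k), (q : V) ≠ 0 ∧
      Function.Surjective g ∧ RingHom.ker g = Ideal.span {(q : V)} := by
  -- The integral polynomial ring with one variable per element of `k` surjects onto `k`; localized
  -- at the kernel it is a local domain of characteristic zero with residue field `k`.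
  let A := MvPolynomial k ℤ
  let ev : A →+* k := MvPolynomial.eval₂Hom (Int.castRingHom k) id
  have hev : Function.Surjective ev := fun x => ⟨MvPolynomial.X x, MvPolynomial.eval₂Hom_X' _ _ _⟩
  let P : Ideal A := RingHom.ker ev
  have hP : P.IsPrime := RingHom.ker_isPrime ev
  let B := Localization.AtPrime P
  have : IsDomain B := IsLocalization.isDomain_localization P.primeCompl_le_nonZeroDivisors
  have : CharZero A := inferInstance
  have : CharZero B := charZero_of_injective_ringHom
    (IsLocalization.injective B P.primeCompl_le_nonZeroDivisors)
  let lft : B →+* k := IsLocalization.lift (M := P.primeCompl) (g := ev) fun y =>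
    isUnit_iff_ne_zero.2 y.2
  have hlft : Function.Surjective lft := fun x => by
    obtain ⟨a, rfl⟩ := hev x
    exact ⟨algebraMap A B a, IsLocalization.lift_eq _ a⟩
  have : IsLocalHom lft := IsLocalHom.of_surjective lft hlft
  let e : ResidueField B ≃+* k := RingEquiv.ofBijective (ResidueField.lift lft)
    ⟨(ResidueField.lift lft).injective, fun x => by
      obtain ⟨b, rfl⟩ := hlft x
      exact ⟨residue B b, ResidueField.lift_residue_apply lft b⟩⟩
  have hq0 : residue B (q : B) = 0 := e.injective (by
    rw [map_natCast, map_natCast, map_zero, CharP.cast_eq_zero])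
  obtain ⟨V, hV1, hV2, hV3, g, h1, h2, h3⟩ := IsLocalRing.exists_isDiscreteValuationRing B hq hq0
  refine ⟨V, hV1, hV2, hV3, (e : _ →+* k).comp g, h1, e.surjective.comp h2, ?_⟩
  rw [← h3]
  exact RingHom.ker_comp_of_injective _ e.injective

/-! ### Coefficient rings: lifting maps along nilpotent ideals. -/

/-- A square-zero extension of a field of characteristic `p` by a ring of characteristic `p`
splits. -/
theorem RingHom.exists_section_of_charP {A k : Type*} [CommRing A] [Field k] {p : ℕ}
    (hp : p.Prime) (hpA : (p : A) = 0) (ρ : A →+* k) (hρ : Function.Surjective ρ)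
    (hsq : ∀ a, ρ a = 0 → a ^ 2 = 0) : ∃ s : k →+* A, ρ.comp s = RingHom.id k := by
  have : Fact p.Prime := ⟨hp⟩
  have : Nontrivial A := ρ.domain_nontrivial
  have : CharP A p := (CharP.charP_iff_prime_eq_zero hp).2 hpA
  have : CharP k p := (CharP.charP_iff_prime_eq_zero hp).2 (by rw [← map_natCast ρ, hpA, map_zero])
  -- Zorn over subrings that contain all `p`-th powers and meet the kernel trivially. The image of
  -- Frobenius qualifies because `p ≥ 2` kills the kernel.
  obtain ⟨B, -, hB⟩ := zorn_le_nonempty₀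
    {B : Subring A | (∀ a, a ^ p ∈ B) ∧ ∀ b ∈ B, ρ b = 0 → b = 0}
    (fun c hc hchain B hB => by
      have hmem := fun v => Subring.mem_sSup_of_directedOn (x := v) ⟨B, hB⟩ hchain.directedOn
      refine ⟨sSup c, ⟨fun a => le_sSup hB ((hc hB).1 a), fun b hb h0 => ?_⟩,
        fun W hW => le_sSup hW⟩
      obtain ⟨W, hW, hbW⟩ := (hmem b).1 hb
      exact (hc hW).2 b hbW h0)
    (frobenius A p).range ⟨fun a => ⟨a, rfl⟩, by
      rintro _ ⟨a, rfl⟩ h0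
      rw [frobenius_def, map_pow] at h0
      rw [frobenius_def]
      exact pow_eq_zero_of_le hp.two_le (hsq a (pow_eq_zero_iff hp.ne_zero |>.1 h0))⟩
  obtain ⟨⟨hpow, hinj⟩, hmax⟩ := hB
  let k' : Subfield k :=
    { (ρ.comp B.subtype).range with
      inv_mem' := by
        rintro _ ⟨b, rfl⟩
        obtain ⟨a, ha⟩ := hρ (ρ b)⁻¹
        -- The inverse is `z⁻¹ = z ^ (p - 1) * (z⁻¹) ^ p`, whose last factor lifts to a `p`-th
        -- power, hence into `B`.
        refine ⟨b ^ (p - 1) * ⟨a ^ p, hpow a⟩, ?_⟩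
        rcases eq_or_ne (ρ b) 0 with h0 | h0
        · simp [h0, ha, hp.ne_zero]
        · obtain ⟨n, hn⟩ := Nat.exists_eq_succ_of_ne_zero hp.ne_zero
          simp only [map_mul, map_pow, RingHom.comp_apply, Subring.subtype_apply, ha, hn]
          simp only [Nat.succ_eq_add_one, Nat.add_sub_cancel, pow_succ, ← mul_assoc, ← mul_pow,
            mul_inv_cancel₀ h0, one_pow, one_mul] }
  have hk' : ∀ b ∈ B, ρ b ∈ k' := fun b hb => ⟨⟨b, hb⟩, rfl⟩
  let ρ' : B →+* k' := (ρ.comp B.subtype).codRestrict k' fun b => hk' b b.2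
  have hsurj : Function.Surjective (ρ.comp B.subtype) := by
    intro x
    by_contra hx
    have hxk : x ∉ k' := fun h => hx h
    obtain ⟨r, rfl⟩ := hρ x
    let a : B := ⟨r ^ p, hpow r⟩
    -- For `x` outside the image, this polynomial is the minimal polynomial of `x`, so adjoining a
    -- lift `r` of `x` to `B` keeps `ρ` injective and contradicts maximality.
    have hirr : Irreducible (X ^ p - C (ρ' a)) := by
      refine X_pow_sub_C_irreducible_of_prime hp fun b hb => hxk ?_
      have h1 : (b : k) ^ p = ρ r ^ p := by
        rw [← map_pow]; exact congrArg Subtype.val hb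
      rw [← frobenius_inj k p h1]
      exact b.2
    have hmon : (X ^ p - C (ρ' a)).Monic := monic_X_pow_sub_C _ hp.ne_zero
    have hmin : X ^ p - C (ρ' a) = minpoly k' (ρ r) := by
      refine minpoly.eq_of_irreducible_of_monic hirr ?_ hmon
      simp only [map_sub, map_pow, aeval_X, aeval_C]
      rw [← map_pow, sub_eq_zero]
      rfl
    have hmonB : (X ^ p - C a).Monic := monic_X_pow_sub_C _ hp.ne_zero
    have hmem := hmax (y := (eval₂RingHom B.subtype r).range) ⟨fun b =>
      ⟨C ⟨_, hpow b⟩, by simp⟩, ?_⟩ fun b hb => ⟨C ⟨b, hb⟩, by simp⟩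
    · exact hxk (hk' r (hmem ⟨X, by simp⟩))
    rintro _ ⟨f, rfl⟩ h0
    have hfg : f.eval₂ B.subtype r = (f %ₘ (X ^ p - C a)).eval₂ B.subtype r := by
      conv_lhs => rw [← modByMonic_add_div f (X ^ p - C a)]
      simp [eval₂_mul, eval₂_add, a]
    have hdeg := degree_modByMonic_lt f hmonB
    rw [coe_eval₂RingHom, hfg] at h0 ⊢
    generalize f %ₘ (X ^ p - C a) = g at *
    have hg0 : g.map ρ' = 0 := by
      by_contra hne
      have h1 := minpoly.degree_le_of_ne_zero k' (ρ r) hne (by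
        rw [aeval_def, eval₂_map, ← h0, hom_eval₂]
        rfl)
      rw [← hmin, degree_X_pow_sub_C hp.pos] at h1
      rw [degree_X_pow_sub_C hp.pos] at hdeg
      exact absurd (h1.trans degree_map_le) (not_le.2 hdeg)
    have : g = 0 := by
      ext i
      have h1 : ((g.map ρ').coeff i : k) = 0 := by rw [hg0]; simp
      rw [coeff_map] at h1
      rw [hinj _ (g.coeff i).2 h1]
      simp
    simp [this]
  let e : B ≃+* k := RingEquiv.ofBijective (ρ.comp B.subtype)
    ⟨(injective_iff_map_eq_zero _).2 fun b hb => Subtype.ext (hinj b b.2 hb), hsurj⟩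
  exact ⟨B.subtype.comp (e.symm : k →+* B), RingHom.ext fun x => e.apply_symm_apply x⟩

/-- Lifting along a square-zero extension `ρ : R → Q` whose kernel is killed by `p`, from a ring in
which `p` is a regular element generating the kernel of a map onto a field. -/
theorem RingHom.exists_lift_of_sq_zero {V k R Q : Type*} [CommRing V] [Field k] [CommRing R]
    [CommRing Q] {p : ℕ} (hp : p.Prime) (hreg : ∀ v : V, p * v = 0 → v = 0) (g : V →+* k)
    (hg : Function.Surjective g) (hker : RingHom.ker g = Ideal.span {(p : V)})
    (ρ : R →+* Q) (hρ : Function.Surjective ρ) (hsq : ∀ a, ρ a = 0 → a ^ 2 = 0)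
    (hpk : ∀ a, ρ a = 0 → p * a = 0) (f : V →+* Q) : ∃ f' : V →+* R, ρ.comp f' = f := by
  -- In the fibre product `E` of `V` and `R` over `Q`, the kernel of `E → V` squares to zero and is
  -- killed by `p`. Hence `E/pE → k` has a square-zero kernel and a section; the preimage `E'` of
  -- the section maps isomorphically onto `V`, and its inverse followed by the projection to `R` is
  -- the lift.
  let E : Subring (V × R) := RingHom.eqLocus (f.comp (RingHom.fst V R)) (ρ.comp (RingHom.snd V R))
  have hE : ∀ z : E, f z.1.1 = ρ z.1.2 := fun z => z.2
  let π : E →+* V := (RingHom.fst V R).comp E.subtype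
  have hπ : Function.Surjective π := fun v => by
    obtain ⟨r, hr⟩ := hρ (f v)
    exact ⟨⟨(v, r), hr.symm⟩, rfl⟩
  have hπp : ∀ z : E, π z = 0 → (p : E) * z = 0 := fun z hz => by
    have h1 : z.1.1 = 0 := hz
    have h2 : (p : R) * z.1.2 = 0 := hpk _ (by rw [← hE, h1, map_zero])
    exact Subtype.ext (Prod.ext (by simp [h1]) (by simpa using h2))
  have hπsq : ∀ z : E, π z = 0 → z ^ 2 = 0 := fun z hz => by
    have h1 : z.1.1 = 0 := hz
    have h2 : z.1.2 ^ 2 = 0 := hsq _ (by rw [← hE, h1, map_zero])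
    exact Subtype.ext (Prod.ext (by simp [h1]) (by simpa using h2))
  let I : Ideal E := Ideal.span {(p : E)}
  let σ : E ⧸ I →+* k := Ideal.Quotient.lift I (g.comp π) fun a ha => by
    obtain ⟨b, rfl⟩ := Ideal.mem_span_singleton.1 ha
    have : g (p : V) = 0 := by
      rw [← RingHom.mem_ker, hker]; exact Ideal.mem_span_singleton_self _
    rw [map_mul, RingHom.comp_apply, map_natCast, this, zero_mul]
  have hdec : ∀ z : E, g (π z) = 0 → ∃ m, π m = 0 ∧ z - m ∈ I := fun z hz => by
    rw [← RingHom.mem_ker, hker, Ideal.mem_span_singleton] at hz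
    obtain ⟨v, hv⟩ := hz
    obtain ⟨w, rfl⟩ := hπ v
    exact ⟨z - p * w, by rw [map_sub, hv, map_mul, map_natCast, sub_self],
      Ideal.mem_span_singleton.2 ⟨w, by ring⟩⟩
  obtain ⟨s, hs⟩ := RingHom.exists_section_of_charP hp
    (by rw [← map_natCast (Ideal.Quotient.mk I), Ideal.Quotient.eq_zero_iff_mem]
        exact Ideal.mem_span_singleton_self _)
    σ (fun x => by
      obtain ⟨v, rfl⟩ := hg x
      obtain ⟨z, rfl⟩ := hπ v
      exact ⟨Ideal.Quotient.mk I z, rfl⟩)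
    (fun a ha => by
      obtain ⟨z, rfl⟩ := Ideal.Quotient.mk_surjective a
      obtain ⟨m, hm, hzm⟩ := hdec z ha
      rw [← Ideal.Quotient.eq.2 hzm |>.symm, ← map_pow, hπsq m hm, map_zero])
  let E' : Subring E := s.range.comap (Ideal.Quotient.mk I)
  have hbij : Function.Bijective (π.comp E'.subtype) := by
    constructor
    · rw [injective_iff_map_eq_zero]
      rintro ⟨z, x, hx⟩ hz
      have hz0 : π z = 0 := hz
      have hx0 : x = 0 := by
        rw [← RingHom.id_apply x, ← hs, RingHom.comp_apply, hx]
        change g (π z) = 0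
        rw [hz0, map_zero]
      rw [hx0, map_zero, eq_comm, Ideal.Quotient.eq_zero_iff_mem, Ideal.mem_span_singleton] at hx
      obtain ⟨w, rfl⟩ := hx
      rw [map_mul, map_natCast] at hz0
      exact Subtype.ext (hπp w (hreg _ hz0))
    · intro v
      obtain ⟨z, rfl⟩ := hπ v
      obtain ⟨z', hz'⟩ := Ideal.Quotient.mk_surjective (s (g (π z)))
      obtain ⟨m, hm, hzm⟩ := hdec (z - z') (by
        have h1 : g (π z') = g (π z) := by
          change σ (Ideal.Quotient.mk I z') = _
          rw [hz', ← RingHom.comp_apply, hs, RingHom.id_apply]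
        rw [map_sub, map_sub, h1, sub_self])
      refine ⟨⟨z - m, g (π z), ?_⟩, ?_⟩
      · rw [← hz']
        exact (Ideal.Quotient.eq.2 (by convert hzm using 1; ring)).symm
      · change π (z - m) = π z
        rw [map_sub, hm, sub_zero]
  let e := RingEquiv.ofBijective _ hbij
  refine ⟨((RingHom.snd V R).comp E.subtype).comp (E'.subtype.comp (e.symm : V →+* E')),
    RingHom.ext fun v => ?_⟩
  obtain ⟨w, rfl⟩ := e.surjective v
  simp only [RingHom.comp_apply, RingHom.coe_coe, e.symm_apply_apply]
  exact (hE w.1).symm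

/-- Lift successively through `R ⧸ I ^ (m + 1)`: each kernel squares to zero and is killed by `p`,
which lies in `I`. -/
theorem RingHom.exists_lift_of_pow_eq_bot {V k R : Type*} [CommRing V] [Field k] [CommRing R]
    {p : ℕ} (hp : p.Prime) (hreg : ∀ v : V, p * v = 0 → v = 0) (g : V →+* k)
    (hg : Function.Surjective g) (hker : RingHom.ker g = Ideal.span {(p : V)})
    {I : Ideal R} (hpI : (p : R) ∈ I) {n : ℕ} (hn : I ^ n = ⊥) (f : V →+* R ⧸ I) :
    ∃ f' : V →+* R, (Ideal.Quotient.mk I).comp f' = f := by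
  suffices h : ∀ m : ℕ, ∃ f' : V →+* R ⧸ I ^ (m + 1),
      (Ideal.Quotient.factor (Ideal.pow_le_self (I := I) m.succ_ne_zero)).comp f' = f by
    obtain ⟨f', rfl⟩ := h n
    have hbot : I ^ (n + 1) = ⊥ := le_bot_iff.1 (hn ▸ Ideal.pow_le_pow_right n.le_succ)
    have hinj : Function.Injective (Ideal.Quotient.mk (I ^ (n + 1))) := by
      rw [RingHom.injective_iff_ker_eq_bot, Ideal.mk_ker, hbot]
    let e := RingEquiv.ofBijective _ ⟨hinj, Ideal.Quotient.mk_surjective⟩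
    refine ⟨(e.symm : _ →+* R).comp f', RingHom.ext fun v => ?_⟩
    obtain ⟨w, hw⟩ := e.surjective (f' v)
    simp only [RingHom.comp_apply, RingHom.coe_coe, ← hw, e.symm_apply_apply]
    rfl
  intro m
  induction m with
  | zero =>
    let e := Ideal.quotEquivOfEq (show I = I ^ (0 + 1) by simp)
    refine ⟨(e : R ⧸ I →+* _).comp f, RingHom.ext fun v => ?_⟩
    obtain ⟨r, hr⟩ := Ideal.Quotient.mk_surjective (f v)
    simp only [RingHom.comp_apply, RingHom.coe_coe, ← hr]
    rfl
  | succ m ih =>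
    obtain ⟨f', rfl⟩ := ih
    have hmem : ∀ a : R ⧸ I ^ (m + 1 + 1),
        Ideal.Quotient.factor (Ideal.pow_le_pow_right (m + 1).le_succ) a = 0 →
        ∃ r ∈ I ^ (m + 1), Ideal.Quotient.mk _ r = a := fun a ha => by
      obtain ⟨r, rfl⟩ := Ideal.Quotient.mk_surjective a
      exact ⟨r, Ideal.Quotient.eq_zero_iff_mem.1 ha, rfl⟩
    obtain ⟨f'', rfl⟩ := exists_lift_of_sq_zero hp hreg g hg hker
      (Ideal.Quotient.factor (Ideal.pow_le_pow_right (I := I) (m + 1).le_succ))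
      (Ideal.Quotient.factor_surjective _)
      (fun a ha => by
        obtain ⟨r, hr, rfl⟩ := hmem a ha
        rw [← map_pow, Ideal.Quotient.eq_zero_iff_mem]
        have := Ideal.pow_mem_pow hr 2
        rw [← pow_mul] at this
        exact Ideal.pow_le_pow_right (by omega) this)
      (fun a ha => by
        obtain ⟨r, hr, rfl⟩ := hmem a ha
        rw [← map_natCast (Ideal.Quotient.mk _), ← map_mul, Ideal.Quotient.eq_zero_iff_mem, pow_succ']
        exact Ideal.mul_mem_mul hpI hr)
      f'
    refine ⟨f'', RingHom.ext fun v => ?_⟩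
    obtain ⟨r, hr⟩ := Ideal.Quotient.mk_surjective (f'' v)
    simp only [RingHom.comp_apply, ← hr]
    rfl

theorem Algebra.FormallySmooth.of_charZero (k : Type*) [Field k] [Algebra ℚ k] :
    Algebra.FormallySmooth ℚ k := by
  obtain ⟨s, hs⟩ := exists_isTranscendenceBasis ℚ k
  have : Algebra.IsAlgebraic (IntermediateField.adjoin ℚ (Set.range ((↑) : s → k))) k :=
    hs.isAlgebraic_field
  exact Algebra.FormallySmooth.of_algebraicIndependent_of_isSeparable hs.1

/-- Nonzero integers are units in `R`, so `R` is a `ℚ`-algebra, and formal smoothness of the residue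
field over `ℚ` lifts the identity through the nilpotent maximal ideal. -/
theorem IsLocalRing.exists_residue_section_of_charZero {R : Type*} [CommRing R] [IsLocalRing R]
    [CharZero (ResidueField R)] {n : ℕ} (hn : maximalIdeal R ^ n = ⊥) :
    ∃ s : ResidueField R →+* R, (residue R).comp s = RingHom.id _ := by
  let i : ℚ →+* R := IsLocalization.lift (M := nonZeroDivisors ℤ) (g := Int.castRingHom R)
    fun y => by
      by_contra hcon
      have h1 := (residue_eq_zero_iff _).2 ((mem_maximalIdeal _).2 hcon)
      simp only [eq_intCast, map_intCast, Int.cast_eq_zero] at h1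
      exact nonZeroDivisors.coe_ne_zero y h1
  let _ : Algebra ℚ R := i.toAlgebra
  have := Algebra.FormallySmooth.of_charZero (ResidueField R)
  obtain ⟨f, hf⟩ := Algebra.FormallySmooth.exists_lift (R := ℚ) (A := ResidueField R)
    (maximalIdeal R) ⟨n, hn⟩
    (RingHom.toRatAlgHom (S := R ⧸ maximalIdeal R) (RingHom.id (ResidueField R)))
  exact ⟨f, RingHom.ext fun x => congrArg (fun g : ResidueField R →ₐ[ℚ] R ⧸ maximalIdeal R => g x) hf⟩

/-- A local ring with nilpotent maximal ideal receives a map from a discrete valuation ring that is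
surjective on residue fields. -/
theorem IsLocalRing.exists_isDiscreteValuationRing_ringHom.{u} {R : Type u} [CommRing R]
    [IsLocalRing R] {n : ℕ} (hn : maximalIdeal R ^ n = ⊥) :
    ∃ (V : Type u) (_ : CommRing V) (_ : IsDomain V) (_ : IsDiscreteValuationRing V)
      (ψ : V →+* R), Function.Surjective ((residue R).comp ψ) := by
  obtain ⟨p, hp⟩ := CharP.exists (ResidueField R)
  rcases CharP.char_is_prime_or_zero (ResidueField R) p with h | rfl
  · obtain ⟨V, h1, h2, h3, g, hp0, hg, hker⟩ :=
      Field.exists_isDiscreteValuationRing (ResidueField R) h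
    obtain ⟨ψ, hψ⟩ := RingHom.exists_lift_of_pow_eq_bot h
      (fun v hv => (mul_eq_zero.1 hv).resolve_left hp0) g hg hker
      (I := maximalIdeal R) (by
        rw [← residue_eq_zero_iff, map_natCast, CharP.cast_eq_zero]) hn g
    exact ⟨V, h1, h2, h3, ψ, by rw [show (residue R).comp ψ = g from hψ]; exact hg⟩
  · have := CharP.charP_to_charZero (ResidueField R)
    obtain ⟨s, hs⟩ := exists_residue_section_of_charZero hn
    refine ⟨PowerSeries (ResidueField R), inferInstance, inferInstance, inferInstance,
      s.comp PowerSeries.constantCoeff, ?_⟩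
    rw [← RingHom.comp_assoc, hs, RingHom.id_comp]
    exact PowerSeries.constantCoeff_surj

/-! ### Covering by a two-dimensional regular local ring. -/

theorem Polynomial.mem_span_X_C_X {V : Type*} [CommRing V] {f : V[X][X]} :
    f ∈ Ideal.span {X, C X} ↔ (f.coeff 0).coeff 0 = 0 := by
  rw [Ideal.mem_span_pair]
  constructor
  · rintro ⟨a, b, rfl⟩; simp
  · intro h0
    obtain ⟨g, hg⟩ := X_dvd_iff.2 h0
    refine ⟨divX f, C g, ?_⟩
    conv_rhs => rw [← divX_mul_X_add f, hg]
    rw [mul_comm X g, C_mul]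

/-- The element `C (C ϖ)` of `V[X][Y]` completes `X, Y` to a regular sequence. -/
theorem Polynomial.isWeaklyRegular_X_X_C {V : Type*} [CommRing V] {ϖ : V}
    (h : ∀ v, ϖ * v = 0 → v = 0) :
    RingTheory.Sequence.IsWeaklyRegular V[X][X] [X, C X, C (C ϖ)] := by
  rw [RingTheory.Sequence.isWeaklyRegular_self_iff]
  have hX : ∀ f : V[X][X], f ∈ Ideal.span {X} ↔ f.coeff 0 = 0 := fun f => by
    rw [Ideal.mem_span_singleton, X_dvd_iff]
  intro i hi u
  match i, hi with
  | 0, _ =>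
    simp only [List.getElem_cons_zero, List.take_zero, Ideal.ofList_nil, Ideal.mem_bot]
    intro hu
    ext1 j
    simpa using congrArg (fun q => q.coeff (j + 1)) hu
  | 1, _ =>
    have : Ideal.ofList ([X, C X, C (C ϖ)].take 1) = Ideal.span {(X : V[X][X])} := by
      simp [Ideal.ofList]
    rw [this, hX, hX]
    simp only [List.getElem_cons_succ, List.getElem_cons_zero, coeff_C_mul]
    intro hu
    ext1 j
    simpa using congrArg (fun q => q.coeff (j + 1)) hu
  | 2, _ =>
    have : Ideal.ofList ([X, C X, C (C ϖ)].take 2) = Ideal.span {(X : V[X][X]), C X} := by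
      rw [Ideal.ofList]; congr 1; ext; simp
    rw [this, mem_span_X_C_X, mem_span_X_C_X]
    simp only [List.getElem_cons_succ, List.getElem_cons_zero, coeff_C_mul]
    exact h _

/-- Approximating the coefficients of `x` and `y` improves an approximation modulo `I ^ m` to one
modulo `I ^ (m + 1)`. -/
theorem Subring.eq_top_of_nilpotent {R : Type*} [CommRing R] (A : Subring R) {I : Ideal R} {n : ℕ}
    (hn : I ^ n = ⊥) {x y : R} (hx : x ∈ A) (hy : y ∈ A) (hI : I = Ideal.span {x, y})
    (hA : ∀ r, ∃ a ∈ A, r - a ∈ I) : A = ⊤ := by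
  have key : ∀ m : ℕ, ∀ r, ∃ a ∈ A, r - a ∈ I ^ m := by
    intro m
    induction m with
    | zero => exact fun r => ⟨0, zero_mem _, by simp⟩
    | succ m ih =>
      intro r
      obtain ⟨a, ha, har⟩ := hA r
      rw [hI, Ideal.mem_span_pair] at har
      obtain ⟨u, v, huv⟩ := har
      obtain ⟨b, hb, hbu⟩ := ih u
      obtain ⟨c, hc, hcv⟩ := ih v
      refine ⟨a + b * x + c * y, add_mem (add_mem ha (mul_mem hb hx)) (mul_mem hc hy), ?_⟩
      have : r - (a + b * x + c * y) = (u - b) * x + (v - c) * y := by linear_combination -huv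
      rw [this, pow_succ]
      exact add_mem (Ideal.mul_mem_mul hbu (hI ▸ Ideal.subset_span (by simp)))
        (Ideal.mul_mem_mul hcv (hI ▸ Ideal.subset_span (by simp)))
  refine eq_top_iff.2 fun r _ => ?_
  obtain ⟨a, ha, har⟩ := key n r
  rw [hn, Ideal.mem_bot, sub_eq_zero] at har
  exact har ▸ ha

/-- Quotient of a three-dimensional regular local ring by an element `z - c`, `c ∈ (x, y)`. -/
theorem IsRegularParameterPair.quotient {B : Type*} [CommRing B] [IsLocalRing B]
    [IsNoetherianRing B] {x y z w a b : B} (hreg : RingTheory.Sequence.IsWeaklyRegular B [y, x, z])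
    (hmax : maximalIdeal B = Ideal.span {x, y, z}) (hw : w = z - (a * x + b * y))
    [IsLocalRing (B ⧸ Ideal.span {w})] :
    IsRegularParameterPair (Ideal.Quotient.mk (Ideal.span {w}) x)
      (Ideal.Quotient.mk _ y) := by
  have hx : x ∈ maximalIdeal B := hmax ▸ Ideal.subset_span (by simp)
  have hy : y ∈ maximalIdeal B := hmax ▸ Ideal.subset_span (by simp)
  have hz : z ∈ maximalIdeal B := hmax ▸ Ideal.subset_span (by simp)
  have hwm : w ∈ maximalIdeal B := by
    rw [hw]
    exact sub_mem hz (add_mem (Ideal.mul_mem_left _ _ hx) (Ideal.mul_mem_left _ _ hy))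
  have hyx : Ideal.ofList [y, x] = Ideal.span {x, y} := by
    rw [Ideal.ofList]; congr 1; ext; simp [or_comm]
  have h1 : RingTheory.Sequence.IsWeaklyRegular B [y, x, w] := by
    rw [RingTheory.Sequence.isWeaklyRegular_self_iff] at hreg ⊢
    intro i hi u
    match i, hi with
    | 0, _ => exact hreg 0 (by simp) u
    | 1, _ => exact hreg 1 (by simp) u
    | 2, _ =>
      have h2 := hreg 2 (by simp) u
      simp only [List.getElem_cons_succ, List.getElem_cons_zero, List.take_succ_cons,
        List.take_zero, hyx] at h2 ⊢
      intro hu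
      refine h2 ?_
      have : z * u = w * u + (a * x + b * y) * u := by rw [hw]; ring
      rw [this]
      exact add_mem hu (Ideal.mul_mem_right _ _ (Ideal.mem_span_pair.2 ⟨a, b, rfl⟩))
  -- Regular sequences in a Noetherian local ring may be permuted; with `w` in front, `x, y` stay
  -- regular modulo `w`.
  have h2 : RingTheory.Sequence.IsWeaklyRegular B [w, x, y] :=
    IsLocalRing.isWeaklyRegular_of_perm_of_subset_maximalIdeal h1
      (by
        refine (List.Perm.swap x y [w]).trans ?_
        refine ((List.Perm.swap w y []).cons x).trans ?_
        exact List.Perm.swap w x [y]) (by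
      intro r hr
      simp only [List.mem_cons, List.not_mem_nil, or_false] at hr
      rcases hr with rfl | rfl | rfl <;> assumption)
  rw [RingTheory.Sequence.isWeaklyRegular_self_iff] at h2
  refine ⟨?_, ?_, ?_⟩
  · rw [← IsLocalRing.map_maximalIdeal_of_surjective _
      (Ideal.Quotient.mk_surjective (I := Ideal.span {w})), hmax, ← Set.image_pair, ← Ideal.map_span]
    refine le_antisymm (Ideal.map_mono (Ideal.span_mono ?_)) ?_
    · rintro _ (rfl | rfl) <;> simp
    · rw [Ideal.map_le_iff_le_comap, Ideal.span_le]
      have hxI := Ideal.mem_map_of_mem (Ideal.Quotient.mk (Ideal.span {w}))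
        (Ideal.subset_span (show x ∈ ({x, y} : Set B) by simp))
      have hyI := Ideal.mem_map_of_mem (Ideal.Quotient.mk (Ideal.span {w}))
        (Ideal.subset_span (show y ∈ ({x, y} : Set B) by simp))
      have h3 : Ideal.Quotient.mk (Ideal.span {w}) z = Ideal.Quotient.mk _ (a * x + b * y) :=
        Ideal.Quotient.eq.2 (hw ▸ Ideal.mem_span_singleton_self _)
      rintro _ (rfl | rfl | rfl)
      · exact hxI
      · exact hyI
      · simp only [Ideal.coe_comap, Set.mem_preimage, SetLike.mem_coe, h3, map_add, map_mul]
        exact add_mem (Ideal.mul_mem_left _ _ hxI) (Ideal.mul_mem_left _ _ hyI)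
  · intro u hu
    obtain ⟨u, rfl⟩ := Ideal.Quotient.mk_surjective u
    rw [← map_mul, Ideal.Quotient.eq_zero_iff_mem] at hu
    rw [Ideal.Quotient.eq_zero_iff_mem]
    simpa [Ideal.ofList] using h2 1 (by simp) u (by simpa [Ideal.ofList] using hu)
  · intro u hu
    obtain ⟨u, rfl⟩ := Ideal.Quotient.mk_surjective u
    have hwx : Ideal.ofList ([w, x, y].take 2) = Ideal.span {w, x} := by
      rw [Ideal.ofList]; congr 1; ext; simp
    have hdvd : ∀ v, Ideal.Quotient.mk (Ideal.span {w}) x ∣ Ideal.Quotient.mk _ v ↔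
        v ∈ Ideal.span {w, x} := fun v => by
      rw [Ideal.mem_span_pair]
      constructor
      · rintro ⟨c, hc⟩
        obtain ⟨c, rfl⟩ := Ideal.Quotient.mk_surjective c
        rw [← map_mul, Ideal.Quotient.eq, Ideal.mem_span_singleton] at hc
        obtain ⟨d, hd⟩ := hc
        exact ⟨d, c, by linear_combination -hd⟩
      · rintro ⟨d, c, rfl⟩
        refine ⟨Ideal.Quotient.mk _ c, ?_⟩
        rw [← map_mul, Ideal.Quotient.eq, Ideal.mem_span_singleton]
        exact ⟨d, by ring⟩
    rw [← map_mul, hdvd] at hu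
    rw [hdvd]
    have := h2 2 (by simp) u
    rw [hwx] at this
    exact this hu

theorem IsRegularParameterPair.exists_quotient.{u} {B R : Type u} [CommRing B] [IsLocalRing B]
    [IsNoetherianRing B] [CommRing R] [Nontrivial R] {x y z w a b : B}
    (hreg : RingTheory.Sequence.IsWeaklyRegular B [y, x, z])
    (hmax : maximalIdeal B = Ideal.span {x, y, z}) (hw : w = z - (a * x + b * y))
    (φ₁ : B →+* R) (hφ₁ : Function.Surjective φ₁) (hφw : φ₁ w = 0) :
    ∃ (S : Type u) (_ : CommRing S) (_ : IsLocalRing S) (_ : IsNoetherianRing S) (s t : S)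
      (φ : S →+* R), IsRegularParameterPair s t ∧ Function.Surjective φ ∧
        φ s = φ₁ x ∧ φ t = φ₁ y := by
  let φ : B ⧸ Ideal.span {w} →+* R := Ideal.Quotient.lift _ φ₁ fun z hz => by
    obtain ⟨c, rfl⟩ := Ideal.mem_span_singleton.1 hz
    rw [map_mul, hφw, zero_mul]
  have : Nontrivial (B ⧸ Ideal.span {w}) := φ.domain_nontrivial
  have : IsLocalRing (B ⧸ Ideal.span {w}) :=
    IsLocalRing.of_surjective' _ Ideal.Quotient.mk_surjective
  exact ⟨B ⧸ Ideal.span {w}, inferInstance, inferInstance, inferInstance, _, _, φ,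
    IsRegularParameterPair.quotient hreg hmax hw,
    Ideal.Quotient.lift_surjective_of_surjective _ _ hφ₁, rfl, rfl⟩

/-- A local ring with nilpotent maximal ideal generated by two elements is a quotient of a
two-dimensional regular local ring. -/
theorem IsLocalRing.exists_regularParameterPair_ringHom.{u} {R : Type u} [CommRing R]
    [IsLocalRing R] {n : ℕ} (hn : maximalIdeal R ^ n = ⊥) {x y : R}
    (hxy : maximalIdeal R = Ideal.span {x, y}) :
    ∃ (S : Type u) (_ : CommRing S) (_ : IsLocalRing S) (_ : IsNoetherianRing S) (s t : S)
      (φ : S →+* R), IsRegularParameterPair s t ∧ Function.Surjective φ ∧ φ s = x ∧ φ t = y := by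
  obtain ⟨V, _, _, _, ψ, hψ⟩ := exists_isDiscreteValuationRing_ringHom hn
  obtain ⟨ϖ, hϖ⟩ := IsDiscreteValuationRing.exists_irreducible V
  have hmV : maximalIdeal V = Ideal.span {ϖ} := hϖ.maximalIdeal_eq
  have hker : ∀ v, ψ v ∈ maximalIdeal R ↔ v ∈ Ideal.span {ϖ} := by
    have : RingHom.ker ((residue R).comp ψ) = maximalIdeal V :=
      eq_maximalIdeal (RingHom.ker_isMaximal_of_surjective _ hψ)
    intro v
    rw [← hmV, ← this, RingHom.mem_ker, RingHom.comp_apply, residue_eq_zero_iff]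
  let φ₀ : V[X][X] →+* R := eval₂RingHom (eval₂RingHom ψ x) y
  have hX : φ₀ X = y := by simp [φ₀]
  have hCX : φ₀ (C X) = x := by simp [φ₀]
  have hCC : ∀ v, φ₀ (C (C v)) = ψ v := fun v => by simp [φ₀]
  have hxm : x ∈ maximalIdeal R := hxy ▸ Ideal.subset_span (by simp)
  have hym : y ∈ maximalIdeal R := hxy ▸ Ideal.subset_span (by simp)
  have hsurj : Function.Surjective φ₀ := by
    rw [← RingHom.range_eq_top]
    refine Subring.eq_top_of_nilpotent _ hn ⟨_, hCX⟩ ⟨_, hX⟩ hxy fun r => ?_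
    obtain ⟨v, hv⟩ := hψ (residue R r)
    refine ⟨ψ v, ⟨_, hCC v⟩, ?_⟩
    rw [← residue_eq_zero_iff, map_sub, ← hv, RingHom.comp_apply, sub_self]
  let P : Ideal V[X][X] := (maximalIdeal R).comap φ₀
  have hP : P = Ideal.span {C X, X, C (C ϖ)} := by
    refine le_antisymm (fun f hf => ?_) ?_
    · have h1 : f - C (C ((f.coeff 0).coeff 0)) ∈ Ideal.span {(X : V[X][X]), C X} :=
        mem_span_X_C_X.2 (by simp)
      have h2 : φ₀ (f - C (C ((f.coeff 0).coeff 0))) ∈ maximalIdeal R := by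
        obtain ⟨a, b, hab⟩ := Ideal.mem_span_pair.1 h1
        rw [← hab, map_add, map_mul, map_mul, hX, hCX]
        exact add_mem (Ideal.mul_mem_left _ _ hym) (Ideal.mul_mem_left _ _ hxm)
      have h3 : ψ ((f.coeff 0).coeff 0) ∈ maximalIdeal R := by
        have := sub_mem (show φ₀ f ∈ maximalIdeal R from hf) h2
        rwa [map_sub, sub_sub_cancel, hCC] at this
      rw [hker, Ideal.mem_span_singleton] at h3
      obtain ⟨v, hv⟩ := h3
      rw [hv, C_mul, C_mul] at h1
      rw [← sub_add_cancel f (C (C ϖ) * C (C v))]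
      refine add_mem (Ideal.span_mono ?_ h1)
        (Ideal.mul_mem_right _ _ (Ideal.subset_span (by simp)))
      rintro _ (rfl | rfl) <;> simp
    · rw [Ideal.span_le]
      rintro _ (rfl | rfl | rfl)
      · change φ₀ (C X) ∈ maximalIdeal R; rwa [hCX]
      · change φ₀ X ∈ maximalIdeal R; rwa [hX]
      · change φ₀ (C (C ϖ)) ∈ maximalIdeal R
        rw [hCC, hker]
        exact Ideal.mem_span_singleton_self _
  have hPp : P.IsPrime := Ideal.comap_isPrime _ _
  let B := Localization.AtPrime P
  have : IsNoetherianRing B := IsLocalization.isNoetherianRing P.primeCompl B inferInstance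
  let φ₁ : B →+* R := IsLocalization.lift (M := P.primeCompl) (g := φ₀) fun f => by
    by_contra hcon
    exact f.2 ((mem_maximalIdeal _).2 hcon)
  have hφ₁ : ∀ f, φ₁ (algebraMap _ B f) = φ₀ f := fun f => IsLocalization.lift_eq _ f
  -- The image of `ϖ` lies in `(x, y)`. Subtracting a lift of such an expression gives an element
  -- `w` of the kernel that can replace `ϖ` as a parameter, and dividing by it leaves `x, y` as
  -- parameters.
  obtain ⟨a, b, hab⟩ := Ideal.mem_span_pair.1
    (hxy ▸ (hker ϖ).2 (Ideal.mem_span_singleton_self ϖ))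
  obtain ⟨a, rfl⟩ := hsurj a
  obtain ⟨b, rfl⟩ := hsurj b
  let α := algebraMap V[X][X] B
  let w : B := α (C (C ϖ)) - (α a * α (C X) + α b * α X)
  have hw : φ₁ w = 0 := by
    simp only [w, α, map_sub, map_add, map_mul, hφ₁, hX, hCX, hCC, hab, sub_self]
  have hmax : maximalIdeal B = Ideal.span {α (C X), α X, α (C (C ϖ))} := by
    have h : P.map α = maximalIdeal B := Localization.AtPrime.map_eq_maximalIdeal
    rw [← h, (congrArg (Ideal.map α) hP :), Ideal.map_span, Set.image_insert_eq,
      Set.image_pair]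
  have hreg := (isWeaklyRegular_X_X_C (ϖ := ϖ) fun v hv =>
    (mul_eq_zero.1 hv).resolve_left hϖ.ne_zero).of_isLocalization B P.primeCompl
  obtain ⟨S, h1, h2, h3, s, t, φ, h, hφ, hs, ht⟩ := IsRegularParameterPair.exists_quotient
    hreg hmax rfl φ₁ (fun r => (hsurj r).imp' α fun f hf => (hφ₁ f).trans hf) hw
  exact ⟨S, h1, h2, h3, s, t, φ, h, hφ, hs.trans ((hφ₁ _).trans hCX), ht.trans ((hφ₁ _).trans hX)⟩

/-! ### Nonzero minors force a zero-dimensional complete intersection. -/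

theorem IsLocalRing.isCompleteIntersection_of_pow_eq_bot {R : Type*} [CommRing R]
    [IsLocalRing R] {n : ℕ} (hn : maximalIdeal R ^ n = ⊥) {x y : R}
    (hxy : maximalIdeal R = Ideal.span {x, y}) {a b c d : R} (h1 : a * x + b * y = 0)
    (h2 : c * x + d * y = 0) (hne : a * d - b * c ≠ 0) :
    IsCompleteIntersectionLocalRing R ∧ ∀ J : Ideal R, J ≠ ⊥ → a * d - b * c ∈ J := by
  obtain ⟨S, _, _, _, s, t, φ, h, hφ, rfl, rfl⟩ := exists_regularParameterPair_ringHom hn hxy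
  obtain ⟨-, -, -, -, hJ⟩ := h.exists_isRegular_ker_eq φ hφ h1 h2 hne
  exact ⟨isCompleteIntersection_of_relations h φ hφ hn h1 h2 hne, hJ⟩

/-- A nonzero minor of relations between two generators of the maximal ideal forces a Noetherian
local ring to be a zero-dimensional complete intersection. -/
theorem IsLocalRing.zeroDimensional_isCompleteIntersection {R : Type*} [CommRing R]
    [IsLocalRing R] [IsNoetherianRing R] {x y : R}
    (hxy : maximalIdeal R = Ideal.span {x, y}) {a b c d : R} (h1 : a * x + b * y = 0)
    (h2 : c * x + d * y = 0) (hne : a * d - b * c ≠ 0) :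
    ringKrullDim R = 0 ∧ IsCompleteIntersectionLocalRing R := by
  obtain ⟨N, hN⟩ : ∃ N : ℕ, a * d - b * c ∉ maximalIdeal R ^ N := by
    by_contra! hcon
    refine hne ?_
    have := Ideal.iInf_pow_eq_bot_of_isLocalRing (maximalIdeal R)
      (maximalIdeal.isMaximal R).ne_top
    rw [← Ideal.mem_bot, ← this, Submodule.mem_iInf]
    exact hcon
  have hbot : maximalIdeal R ^ N = ⊥ := by
    let I := maximalIdeal R ^ (N + 1)
    let π := Ideal.Quotient.mk I
    have hI : I ≤ maximalIdeal R ^ N := Ideal.pow_le_pow_right N.le_succ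
    have : Nontrivial (R ⧸ I) := Ideal.Quotient.nontrivial_iff.2 fun h =>
      (maximalIdeal.isMaximal R).ne_top
        (top_le_iff.1 (h ▸ Ideal.pow_le_self N.succ_ne_zero))
    have : IsLocalRing (R ⧸ I) := IsLocalRing.of_surjective' _ Ideal.Quotient.mk_surjective
    have hmap : (maximalIdeal R).map π = maximalIdeal (R ⧸ I) :=
      IsLocalRing.map_maximalIdeal_of_surjective _ Ideal.Quotient.mk_surjective
    have hpow : maximalIdeal (R ⧸ I) ^ (N + 1) = ⊥ := by
      rw [← hmap, ← Ideal.map_pow, Ideal.map_quotient_self]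
    have hxy' : maximalIdeal (R ⧸ I) = Ideal.span {π x, π y} := by
      rw [← hmap, hxy, Ideal.map_span, Set.image_pair]
    have hdet : π a * π d - π b * π c = π (a * d - b * c) := by simp
    have hall := (isCompleteIntersection_of_pow_eq_bot hpow hxy'
      (a := π a) (b := π b) (c := π c) (d := π d)
      (by rw [← map_mul, ← map_mul, ← map_add, h1, map_zero])
      (by rw [← map_mul, ← map_mul, ← map_add, h2, map_zero])
      (by
        rw [hdet, Ne, Ideal.Quotient.eq_zero_iff_mem]
        exact fun h => hN (hI h))).2 ((maximalIdeal R ^ N).map π)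
    -- If nonzero, this ideal would contain the image of the minor, placing the minor in `𝔪^N`.
    have hmapbot : (maximalIdeal R ^ N).map π = ⊥ := by
      by_contra hcon
      have := hall hcon
      rw [hdet, ← Ideal.mem_comap, Ideal.comap_map_of_surjective _ Ideal.Quotient.mk_surjective,
        ← RingHom.ker_eq_comap_bot, Ideal.mk_ker, sup_eq_left.2 hI] at this
      exact hN this
    rw [Ideal.map_eq_bot_iff_le_ker, Ideal.mk_ker] at hmapbot
    refine Submodule.eq_bot_of_le_smul_of_le_jacobson_bot (maximalIdeal R) _
      (IsNoetherian.noetherian _) ?_ (maximalIdeal_le_jacobson _)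
    rw [smul_eq_mul, ← pow_succ']
    exact hmapbot
  refine ⟨?_, (isCompleteIntersection_of_pow_eq_bot hbot hxy h1 h2 hne).1⟩
  have : Ring.KrullDimLE 0 R := Ring.krullDimLE_zero_iff.2 fun P hP => by
    have : maximalIdeal R ≤ P := hP.le_of_pow_le (n := N) (hbot ▸ bot_le)
    rw [← (maximalIdeal.isMaximal R).eq_of_le hP.ne_top this]
    exact maximalIdeal.isMaximal R
  exact ringKrullDimZero_iff_ringKrullDim_eq_zero.1 this

/-! ### Minimal covers, syzygies and the dual of the maximal ideal. -/

/-- By minimality, a vector mapping to zero in the cotangent space has all coordinates in the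
maximal ideal, so the standard basis maps to a basis. -/
theorem IsMinimalFreeCover.eq_finrank_cotangentSpace {R : Type*} [CommRing R] [IsLocalRing R]
    {n : ℕ} {π : (Fin n → R) →ₗ[R] maximalIdeal R} (hπ : IsMinimalFreeCover π) :
    Module.finrank (ResidueField R) (CotangentSpace R) = n := by
  let q : (Fin n → R) →ₗ[R] CotangentSpace R := (maximalIdeal R).toCotangent.comp π
  have hq : Function.Surjective q :=
    (Ideal.toCotangent_surjective _).comp hπ.surjective
  have hqsum : ∀ c : Fin n → R, q c = ∑ i, residue R (c i) • q (Pi.single i 1) := fun c => by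
    conv_lhs => rw [pi_eq_sum_univ' c, map_sum]
    refine Finset.sum_congr rfl fun i _ => ?_
    rw [map_smul]
    rfl
  have hmem : ∀ c ∈ maximalIdeal R • (⊤ : Submodule R (Fin n → R)), ∀ i, c i ∈ maximalIdeal R := by
    intro c hc i
    have := Submodule.mem_map_of_mem (f := LinearMap.proj (R := R) (φ := fun _ : Fin n => R) i) hc
    rw [Submodule.map_smul'', smul_eq_mul] at this
    exact Ideal.mul_le_left this
  have hker : ∀ c, q c = 0 → ∀ i, c i ∈ maximalIdeal R := by
    intro c hc
    have h1 : π c ∈ maximalIdeal R • (⊤ : Submodule R (maximalIdeal R)) :=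
      (Submodule.Quotient.mk_eq_zero _).1 hc
    rw [← LinearMap.range_eq_top.2 hπ.surjective, ← Submodule.map_top, ← Submodule.map_smul''] at h1
    obtain ⟨v, hv, hvc⟩ := h1
    have h2 := hπ.ker_le (x := c - v) (by rw [LinearMap.mem_ker, map_sub, hvc, sub_self])
    refine hmem c ?_
    rw [← sub_add_cancel c v]
    exact add_mem h2 hv
  have hli : LinearIndependent (ResidueField R) fun i => q (Pi.single i 1) := by
    rw [Fintype.linearIndependent_iff]
    intro g hg i
    choose c hc using fun i => residue_surjective (g i)
    simp only [← hc] at hg ⊢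
    rw [← hqsum] at hg
    exact (residue_eq_zero_iff _).2 (hker c hg i)
  have hspan : ⊤ ≤ Submodule.span (ResidueField R) (Set.range fun i => q (Pi.single i 1)) := by
    intro z _
    obtain ⟨c, rfl⟩ := hq z
    rw [hqsum]
    exact sum_mem fun i _ => Submodule.smul_mem _ _ (Submodule.subset_span ⟨i, rfl⟩)
  rw [Module.finrank_eq_card_basis (Module.Basis.mk hli hspan), Fintype.card_fin]

/-- If all minors of relations between two generators of an ideal vanish, then the relation module
is dual to the ideal. -/
theorem Ideal.nonempty_ker_equiv_dual {R : Type*} [CommRing R] {I : Ideal R}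
    (π : (Fin 2 → R) →ₗ[R] I) (hπ : Function.Surjective π)
    (hdet : ∀ u ∈ LinearMap.ker π, ∀ v ∈ LinearMap.ker π, u 0 * v 1 - u 1 * v 0 = 0) :
    Nonempty (LinearMap.ker π ≃ₗ[R] Module.Dual R I) := by
  let e₀ : Fin 2 → R := ![1, 0]
  let e₁ : Fin 2 → R := ![0, 1]
  have he : ∀ u : Fin 2 → R, u = u 0 • e₀ + u 1 • e₁ := fun u => by
    ext i; fin_cases i <;> simp [e₀, e₁]
  have hπe : ∀ u : Fin 2 → R, π u = u 0 • π e₀ + u 1 • π e₁ := fun u => by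
    conv_lhs => rw [he u, map_add, map_smul, map_smul]
  let F : Module.Dual R I →ₗ[R] (Fin 2 → R) :=
    LinearMap.pi ![-(LinearMap.applyₗ (π e₁)), LinearMap.applyₗ (π e₀)]
  have hF0 : ∀ f, F f 0 = -f (π e₁) := fun f => rfl
  have hF1 : ∀ f, F f 1 = f (π e₀) := fun f => rfl
  have hF : ∀ f, F f ∈ LinearMap.ker π := fun f => by
    rw [LinearMap.mem_ker, hπe, hF0, hF1]
    have hI : ∀ z w : I, f w * (z : R) = f z * w := fun z w => by
      have : (z : R) • w = (w : R) • z := Subtype.ext (mul_comm _ _)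
      have h := congrArg f this
      simp only [map_smul, smul_eq_mul] at h
      linear_combination h
    refine Subtype.ext ?_
    simp only [Submodule.coe_add, Submodule.coe_smul, smul_eq_mul, Submodule.coe_zero]
    linear_combination -hI (π e₀) (π e₁)
  refine ⟨(LinearEquiv.ofBijective (F.codRestrict _ hF) ⟨?_, ?_⟩).symm⟩
  · rw [injective_iff_map_eq_zero]
    intro f hf
    have hf' : F f = 0 := congrArg Subtype.val hf
    ext z
    obtain ⟨u, rfl⟩ := hπ z
    have h0 : f (π e₁) = 0 := neg_eq_zero.1 ((hF0 f).symm.trans (congrFun hf' 0))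
    have h1 : f (π e₀) = 0 := (hF1 f).symm.trans (congrFun hf' 1)
    simp [hπe u, h0, h1]
  · rintro ⟨u, hu⟩
    -- The functional inverting `F` at `u`; the vanishing minors make it descend to `I`.
    let g : (Fin 2 → R) →ₗ[R] R :=
      u 1 • LinearMap.proj (R := R) (φ := fun _ : Fin 2 => R) 0 -
        u 0 • LinearMap.proj (R := R) (φ := fun _ : Fin 2 => R) 1
    have hg : LinearMap.ker π ≤ LinearMap.ker g := fun v hv => by
      have := hdet u hu v hv
      simp only [g, LinearMap.mem_ker, LinearMap.sub_apply, LinearMap.smul_apply,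
        LinearMap.proj_apply, smul_eq_mul]
      linear_combination -this
    let f : Module.Dual R I := ((LinearMap.ker π).liftQ g hg).comp
      (π.quotKerEquivOfSurjective hπ).symm.toLinearMap
    have hf : ∀ v, f (π v) = g v := fun v => by
      have : (π.quotKerEquivOfSurjective hπ).symm (π v) = Submodule.Quotient.mk v := by
        rw [LinearEquiv.symm_apply_eq]; rfl
      change (LinearMap.ker π).liftQ g hg ((π.quotKerEquivOfSurjective hπ).symm (π v)) = _
      rw [this]; rfl
    refine ⟨f, Subtype.ext (funext fun i => ?_)⟩
    fin_cases i
    · change -f (π e₁) = u 0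
      simp [hf, g, e₁]
    · change f (π e₀) = u 1
      simp [hf, g, e₀]

theorem theorem2p1 {R : Type*} [CommRing R] [IsLocalRing R] [IsNoetherianRing R]
    (hdim : Module.finrank (IsLocalRing.ResidueField R) (IsLocalRing.CotangentSpace R) = 2)
    (hR : ¬ (ringKrullDim R = 0 ∧ IsCompleteIntersectionLocalRing R))
    {n : ℕ} (π : (Fin n → R) →ₗ[R] IsLocalRing.maximalIdeal R) (hπ : IsMinimalFreeCover π) :
    Nonempty (LinearMap.ker π ≃ₗ[R] Module.Dual R (IsLocalRing.maximalIdeal R)) := by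
  obtain rfl : n = 2 := hπ.eq_finrank_cotangentSpace.symm.trans hdim
  have hπu : ∀ u : Fin 2 → R, (π u : R) = u 0 * π (Pi.single 0 1) + u 1 * π (Pi.single 1 1) := by
    intro u
    conv_lhs => rw [pi_eq_sum_univ' u, map_sum, Fin.sum_univ_two, map_smul, map_smul]
    rfl
  have hxy : maximalIdeal R =
      Ideal.span {(π (Pi.single 0 1) : R), (π (Pi.single 1 1) : R)} := by
    refine le_antisymm (fun z hz => ?_) ?_
    · obtain ⟨u, hu⟩ := hπ.surjective ⟨z, hz⟩
      exact Ideal.mem_span_pair.2 ⟨u 0, u 1, by rw [← hπu, hu]⟩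
    · rw [Ideal.span_le]
      rintro _ (rfl | rfl) <;> exact Subtype.coe_prop _
  refine Ideal.nonempty_ker_equiv_dual π hπ.surjective fun u hu v hv => ?_
  by_contra hne
  have hrel : ∀ u ∈ LinearMap.ker π, u 0 * π (Pi.single 0 1) + u 1 * π (Pi.single 1 1) = (0 : R) :=
    fun u hu => by rw [← hπu, LinearMap.mem_ker.1 hu, Submodule.coe_zero]
  exact hR (zeroDimensional_isCompleteIntersection hxy (hrel u hu) (hrel v hv) hne)
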